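/- Let $n\ge 2$, let $\mathbb S^{n-1}\subset\mathbb R^n$ be the unit sphere with normalized surface measure $d\mathbf u$, and let $\mathbb Y^{2n}=\mathbb S^{n-1}\times\mathbb R\times\mathbb R^n$ with the measure $db\,d\mathbf a\,d\mathbf u$. Let $\mathcal S(\mathbb Y^{2n})$ be the space of smooth $\Phi:\mathbb Y^{2n}\to\mathbb C$ such that $$\rho_{s,r}^{l,m,k}(\Phi)=\sup_{(\mathbf u,b,\mathbf a)\in\mathbb Y^{2n}}(1+|b|^2)^{r/2}(1+|\mathbf a|^2)^{s/2}\,|\partial_{\mathbf a}^l\partial_b^m\Delta_{\mathbf u}^k\Phi(\mathbf u,b,\mathbf a)|<\infty$$ for all $s,r,m,k\in\mathbb N_0$, $l\in\mathbb N_0^n$ ($\Delta_{\mathbf u}$ is the Laplace–Beltrami operator of $\mathbb S^{n-1}$), with the topology given by these seminorms. Let $\mathcal S'(\mathbb R^n)$ and $\mathcal S'(\mathbb Y^{2n})$ be the dual spaces of $\mathcal S(\mathbb R^n)$ and $\mathcal S(\mathbb Y^{2n})$, with their strong dual topologies. Let $\alpha=(\alpha_1,\dots,\alpha_n)$ with $\alpha_k\in(-\pi,\pi)\setminus\{0\}$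 and put $$K_\alpha(\mathbf x,\boldsymbol\xi)=\prod_{k=1}^n\sqrt{\tfrac{1-i\cot\alpha_k}{2\pi}}\;e^{i\left(\frac{x_k^2+\xi_k^2}{2}\cot\alpha_k-x_k\xi_k\csc\alpha_k\right)}$$ (principal square root). For $\psi\in\mathcal S(\mathbb R)$, $\varphi\in\mathcal S(\mathbb R^n)$ and $\Phi\in\mathcal S(\mathbb Y^{2n})$ let $$DS_\psi^\alpha\varphi(\mathbf u,b,\mathbf a)=\int_{\mathbb R^n}\varphi(\mathbf x)\,\overline{\psi(\mathbf u\cdot\mathbf x-b)}\,K_\alpha(\mathbf x,\mathbf a)\,d\mathbf x,$$ $$(DS_\psi^\alpha)^*\Phi(\mathbf x)=\int_{\mathbb S^{n-1}}\int_{\mathbb R^n}\int_{\mathbb R}\Phi(\mathbf u,b,\mathbf a)\,\psi(\mathbf x\cdot\mathbf u-b)\,K_{-\alpha}(\mathbf x,\mathbf a)\,db\,d\mathbf a\,d\mathbf u .$$ **Proposition.** Let $\psi\in\mathcal S(\mathbb R)$. The integrals above converge absolutely and define continuous linear maps $DS_\psi^\alpha:\mathcal S(\mathbb R^n)\to\mathcal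 S(\mathbb Y^{2n})$ and $(DS_\psi^\alpha)^*:\mathcal S(\mathbb Y^{2n})\to\mathcal S(\mathbb R^n)$. The maps $DS_\psi^\alpha$ on $\mathcal S'(\mathbb R^n)$ and $(DS_\psi^\alpha)^*$ on $\mathcal S'(\mathbb Y^{2n})$ given by $$\langle DS_\psi^\alpha f,\Phi\rangle=\big\langle f,\overline{(DS_\psi^\alpha)^*(\overline\Phi)}\big\rangle,\qquad \langle (DS_\psi^\alpha)^*F,\varphi\rangle=\big\langle F,\overline{DS_\psi^\alpha(\overline\varphi)}\big\rangle$$ for $f\in\mathcal S'(\mathbb R^n)$, $F\in\mathcal S'(\mathbb Y^{2n})$, $\Phi\in\mathcal S(\mathbb Y^{2n})$, $\varphi\in\mathcal S(\mathbb R^n)$, are well-defined continuous linear maps $$DS_\psi^\alpha:\mathcal S'(\mathbb R^n)\to\mathcal S'(\mathbb Y^{2n}),\qquad (DS_\psi^\alpha)^*:\mathcal S'(\mathbb Y^{2n})\to\mathcal S'(\mathbb R^n).$$ -/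

import Mathlib

open scoped Manifold ContDiff SchwartzMap ComplexConjugate

noncomputable section

namespace DSTFRFT

/-- Euclidean space `ℝⁿ` with `n = d + 1`. -/
abbrev Rn (d : ℕ) : Type := EuclideanSpace ℝ (Fin (d + 1))

/-- The unit sphere `𝕊ⁿ⁻¹` of `ℝⁿ`, `n = d + 1`. -/
abbrev Sph (d : ℕ) : Type := Metric.sphere (0 : Rn d) 1

/-- `𝕐²ⁿ = 𝕊ⁿ⁻¹ × ℝ × ℝⁿ`, with points `(u, b, a)`. -/
abbrev Y (d : ℕ) : Type := Sph d × ℝ × Rn d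

/-! ### The transforms on functions -/

/-- The one-dimensional fractional Fourier kernel `K_θ(x, ξ)` for `θ ∉ πℤ` (the only angles used
below), with the principal square root in the constant. -/
def kernelOne (θ x ξ : ℝ) : ℂ :=
  ((1 - Complex.I * (Real.cot θ : ℂ)) / (2 * (Real.pi : ℂ))) ^ (1 / 2 : ℂ) *
    Complex.exp (Complex.I *
      (((x ^ 2 + ξ ^ 2) / 2 * Real.cot θ - x * ξ * (Real.sin θ)⁻¹ : ℝ) : ℂ))

/-- The `n`-dimensional fractional Fourier kernel `K_α(x, ξ) = ∏ₖ K_{αₖ}(xₖ, ξₖ)`. -/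
def kernel {d : ℕ} (α : Fin (d + 1) → ℝ) (x ξ : Rn d) : ℂ :=
  ∏ k, kernelOne (α k) (x k) (ξ k)

/-- The integrand of the directional short-time fractional Fourier transform. -/
def dstfrftIntegrand {d : ℕ} (ψ : ℝ → ℂ) (α : Fin (d + 1) → ℝ) (f : Rn d → ℂ) (p : Y d)
    (x : Rn d) : ℂ :=
  f x * conj (ψ (inner ℝ (p.1 : Rn d) x - p.2.1)) * kernel α x p.2.2

/-- The directional short-time fractional Fourier transform `DS_ψ^α f (u, b, a)` of a function. -/
def dstfrft {d : ℕ} (ψ : ℝ → ℂ) (α : Fin (d + 1) → ℝ) (f : Rn d → ℂ) (p : Y d) : ℂ :=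
  ∫ x, dstfrftIntegrand ψ α f p x

/-- The normalized surface measure on the unit sphere. -/
def sphereMeasure (d : ℕ) : MeasureTheory.Measure (Sph d) :=
  ((MeasureTheory.volume : MeasureTheory.Measure (Rn d)).toSphere Set.univ)⁻¹ •
    (MeasureTheory.volume : MeasureTheory.Measure (Rn d)).toSphere

/-- The standard measure `db da du` on `𝕐²ⁿ`. -/
def measureY (d : ℕ) : MeasureTheory.Measure (Y d) :=
  (sphereMeasure d).prod
    ((MeasureTheory.volume : MeasureTheory.Measure ℝ).prod
      (MeasureTheory.volume : MeasureTheory.Measure (Rn d)))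

/-- The integrand of the synthesis operator. -/
def synthesisIntegrand {d : ℕ} (ψ : ℝ → ℂ) (α : Fin (d + 1) → ℝ) (Φ : Y d → ℂ) (x : Rn d)
    (p : Y d) : ℂ :=
  Φ p * ψ (inner ℝ x (p.1 : Rn d) - p.2.1) * kernel (-α) x p.2.2

/-- The directional short-time fractional Fourier synthesis operator `(DS_ψ^α)^* Φ (x)`. -/
def synthesis {d : ℕ} (ψ : ℝ → ℂ) (α : Fin (d + 1) → ℝ) (Φ : Y d → ℂ) (x : Rn d) : ℂ :=
  ∫ p, synthesisIntegrand ψ α Φ x p ∂(measureY d)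

/-! ### Differential operators on `𝕐²ⁿ` -/

/-- Smoothness on the manifold `𝕐²ⁿ`. -/
def IsSmooth {d : ℕ} (Φ : Y d → ℂ) : Prop :=
  ContMDiff ((𝓡 d).prod 𝓘(ℝ, ℝ × Rn d)) 𝓘(ℝ, ℂ) ∞ Φ

/-- A point of the sphere, the (irrelevant) value of the radial projection at the origin. -/
def pole (d : ℕ) : Sph d :=
  ⟨EuclideanSpace.single 0 1, by simp⟩

/-- The radial projection `x ↦ x / |x|` onto the sphere. -/
def radial {d : ℕ} (x : Rn d) : Sph d :=
  if h : x = 0 then pole d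
  else ⟨‖x‖⁻¹ • x, by simp [norm_smul, norm_ne_zero_iff.2 h]⟩

open Laplacian in
/-- The Laplace-Beltrami operator `Δ_u` of the sphere: the Euclidean Laplacian of the extension that
is homogeneous of degree zero, restricted to the sphere. -/
def sphLaplacian {d : ℕ} (Φ : Y d → ℂ) : Y d → ℂ :=
  fun p => Δ (fun x : Rn d => Φ (radial x, p.2)) (p.1 : Rn d)

/-- The partial derivative `∂_b`. -/
def partialB {d : ℕ} (Φ : Y d → ℂ) : Y d → ℂ :=
  fun p => fderiv ℝ (fun t : ℝ => Φ (p.1, t, p.2.2)) p.2.1 1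

/-- The partial derivative `∂_{a_j}`. -/
def partialA {d : ℕ} (j : Fin (d + 1)) (Φ : Y d → ℂ) : Y d → ℂ :=
  fun p => fderiv ℝ (fun a : Rn d => Φ (p.1, p.2.1, a)) p.2.2 (EuclideanSpace.single j 1)

/-- The operator `∂_a^l` for a multi-index `l`. -/
def partialAMulti {d : ℕ} (l : Fin (d + 1) → ℕ) : (Y d → ℂ) → (Y d → ℂ) :=
  (List.finRange (d + 1)).foldr (fun j T => (partialA j)^[l j] ∘ T) id

/-- The operator `∂_a^l ∂_b^m Δ_u^k`. -/
def mixedDeriv {d : ℕ} (m k : ℕ) (l : Fin (d + 1) → ℕ) (Φ : Y d → ℂ) : Y d → ℂ :=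
  partialAMulti l (partialB^[m] (sphLaplacian^[k] Φ))

/-- The quantity `(1+|b|²)^{r/2} (1+|a|²)^{s/2} |∂_a^l ∂_b^m Δ_u^k Φ(u,b,a)|`. -/
def weighted {d : ℕ} (s r m k : ℕ) (l : Fin (d + 1) → ℕ) (Φ : Y d → ℂ) (p : Y d) : ℝ :=
  (1 + |p.2.1| ^ 2) ^ ((r : ℝ) / 2) * (1 + ‖p.2.2‖ ^ 2) ^ ((s : ℝ) / 2) * ‖mixedDeriv m k l Φ p‖

/-! ### Algebraic rules for these operators on smooth functions -/

theorem radial_coe {d : ℕ} (u : Sph d) : radial (u : Rn d) = u := by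
  have h1 : ‖(u : Rn d)‖ = 1 := norm_eq_of_mem_sphere u
  have h : (u : Rn d) ≠ 0 := by
    intro h0
    simp [h0] at h1
  ext1
  simp [radial, h, h1]

theorem contMDiffAt_radial {d : ℕ} {x : Rn d} (hx : x ≠ 0) :
    ContMDiffAt 𝓘(ℝ, Rn d) (𝓡 d) ∞ (radial : Rn d → Sph d) x := by
  have hcoe : (fun y : Rn d => (radial y : Rn d)) =ᶠ[nhds x] fun y => ‖y‖⁻¹ • y := by
    filter_upwards [isOpen_ne.mem_nhds hx] with y hy
    simp [radial, show y ≠ 0 from hy]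
  have hsm : ContDiffAt ℝ ∞ (fun y : Rn d => (radial y : Rn d)) x := by
    refine ContDiffAt.congr_of_eventuallyEq ?_ hcoe
    exact ((contDiffAt_norm ℝ hx).inv (norm_ne_zero_iff.2 hx)).smul contDiffAt_id
  have : Fact (Module.finrank ℝ (Rn d) = d + 1) := ⟨finrank_euclideanSpace_fin⟩
  rw [contMDiffAt_iff_target]
  refine ⟨Topology.IsInducing.subtypeVal.continuousAt_iff.2 hsm.continuousAt, ?_⟩
  set v : Sph d := radial x with hv
  let U : _ ≃ₗᵢ[ℝ] _ :=
    (OrthonormalBasis.fromOrthogonalSpanSingleton (𝕜 := ℝ) d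
      (ne_zero_of_mem_unit_sphere (-v))).repr
  have h1 : ContDiffAt ℝ ∞ (stereoToFun ((-v : Sph d) : Rn d)) (v : Rn d) := by
    refine contDiffOn_stereoToFun.contDiffAt (IsOpen.mem_nhds ?_ ?_)
    · exact isOpen_ne_fun (innerSL ℝ _).continuous continuous_const
    · simp [norm_eq_of_mem_sphere v]
      norm_num
  exact (U.contDiff.contDiffAt.comp x (h1.comp x hsm)).contMDiffAt

/-- The extension of `Φ` that is homogeneous of degree zero in the first variable. -/
def lift {d : ℕ} (Φ : Y d → ℂ) : Rn d × ℝ × Rn d → ℂ := fun q => Φ (radial q.1, q.2)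

theorem IsSmooth.lift {d : ℕ} {Φ : Y d → ℂ} (h : IsSmooth Φ) {q : Rn d × ℝ × Rn d}
    (hq : q.1 ≠ 0) : ContDiffAt ℝ ∞ (lift Φ) q := by
  rw [← contMDiffAt_iff_contDiffAt]
  have h1 : ContMDiffAt 𝓘(ℝ, Rn d × ℝ × Rn d) (𝓡 d) ∞
      (fun q : Rn d × ℝ × Rn d => radial q.1) q :=
    (contMDiffAt_radial hq).comp q contDiffAt_fst.contMDiffAt
  have h2 : ContMDiffAt 𝓘(ℝ, Rn d × ℝ × Rn d) 𝓘(ℝ, ℝ × Rn d) ∞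
      (fun q : Rn d × ℝ × Rn d => q.2) q := contDiffAt_snd.contMDiffAt
  exact (h _).comp q (h1.prodMk h2)

theorem isSmooth_of_contDiffAt {d : ℕ} {G : Rn d × ℝ × Rn d → ℂ}
    (h : ∀ q : Rn d × ℝ × Rn d, q.1 ≠ 0 → ContDiffAt ℝ ∞ G q) :
    IsSmooth (fun p : Y d => G ((p.1 : Rn d), p.2)) := by
  intro p
  have : Fact (Module.finrank ℝ (Rn d) = d + 1) := ⟨finrank_euclideanSpace_fin⟩
  have h1 : ContMDiffAt ((𝓡 d).prod 𝓘(ℝ, ℝ × Rn d)) 𝓘(ℝ, Rn d) ∞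
      (fun p : Y d => (p.1 : Rn d)) p :=
    (contMDiff_coe_sphere (E := Rn d) p.1).comp p contMDiffAt_fst
  have h2 : ContMDiffAt ((𝓡 d).prod 𝓘(ℝ, ℝ × Rn d)) 𝓘(ℝ, ℝ × Rn d) ∞
      (fun p : Y d => p.2) p := contMDiffAt_snd
  have hp : (p.1 : Rn d) ≠ 0 := ne_zero_of_mem_unit_sphere p.1
  exact (h ((p.1 : Rn d), p.2) hp).contMDiffAt.comp p (h1.prodMk_space h2)

/-- Operators that act linearly on smooth functions, keep them smooth, and commute with
complex conjugation. -/
structure IsRegularOp {d : ℕ} (T : (Y d → ℂ) → (Y d → ℂ)) : Prop where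
  smooth : ∀ {Φ}, IsSmooth Φ → IsSmooth (T Φ)
  add : ∀ {Φ Ψ}, IsSmooth Φ → IsSmooth Ψ → T (Φ + Ψ) = T Φ + T Ψ
  smul : ∀ (c : ℂ) {Φ}, IsSmooth Φ → T (c • Φ) = c • T Φ
  map_conj : ∀ Φ : Y d → ℂ, T (fun p => conj (Φ p)) = fun p => conj (T Φ p)

theorem IsSmooth.add {d : ℕ} {Φ Ψ : Y d → ℂ} (h : IsSmooth Φ) (h' : IsSmooth Ψ) :
    IsSmooth (Φ + Ψ) := ContMDiff.add h h'

theorem IsSmooth.smul {d : ℕ} (c : ℂ) {Φ : Y d → ℂ} (h : IsSmooth Φ) : IsSmooth (c • Φ) :=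
  ((c • ContinuousLinearMap.id ℝ ℂ : ℂ →L[ℝ] ℂ).contDiff.contMDiff).comp h

theorem IsSmooth.conjugate {d : ℕ} {Φ : Y d → ℂ} (h : IsSmooth Φ) :
    IsSmooth (fun p => conj (Φ p)) :=
  (Complex.conjCLE.contDiff.contMDiff).comp h

theorem IsRegularOp.id {d : ℕ} : IsRegularOp (id : (Y d → ℂ) → (Y d → ℂ)) where
  smooth h := h
  add _ _ := rfl
  smul _ _ _ := rfl
  map_conj _ := rfl

theorem IsRegularOp.comp {d : ℕ} {S T : (Y d → ℂ) → (Y d → ℂ)} (hS : IsRegularOp S)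
    (hT : IsRegularOp T) : IsRegularOp (S ∘ T) where
  smooth h := hS.smooth (hT.smooth h)
  add h h' := by
    simp only [Function.comp_apply]
    rw [hT.add h h', hS.add (hT.smooth h) (hT.smooth h')]
  smul c _ h := by
    simp only [Function.comp_apply]
    rw [hT.smul c h, hS.smul c (hT.smooth h)]
  map_conj Φ := by
    simp only [Function.comp_apply]
    rw [hT.map_conj, hS.map_conj]

theorem IsRegularOp.iterate {d : ℕ} {T : (Y d → ℂ) → (Y d → ℂ)} (hT : IsRegularOp T) (k : ℕ) :
    IsRegularOp T^[k] := by
  induction k with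
  | zero => exact IsRegularOp.id
  | succ k ih =>
    rw [Function.iterate_succ']
    exact hT.comp ih

theorem IsSmooth.slice_radial {d : ℕ} {Φ : Y d → ℂ} (h : IsSmooth Φ) (p : Y d) :
    ContDiffAt ℝ ∞ (fun x : Rn d => Φ (radial x, p.2)) (p.1 : Rn d) :=
  (h.lift (q := ((p.1 : Rn d), p.2)) (ne_zero_of_mem_unit_sphere p.1)).comp (p.1 : Rn d)
    (f := fun x : Rn d => (x, p.2)) (contDiffAt_id.prodMk contDiffAt_const)

theorem IsSmooth.slice_b {d : ℕ} {Φ : Y d → ℂ} (h : IsSmooth Φ) (p : Y d) :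
    ContDiffAt ℝ ∞ (fun t : ℝ => Φ (p.1, t, p.2.2)) p.2.1 := by
  have := (h.lift (q := ((p.1 : Rn d), p.2)) (ne_zero_of_mem_unit_sphere p.1)).comp p.2.1
    (f := fun t : ℝ => ((p.1 : Rn d), t, p.2.2))
    (contDiffAt_const.prodMk (contDiffAt_id.prodMk contDiffAt_const))
  simpa [Function.comp_def, DSTFRFT.lift, radial_coe] using this

theorem IsSmooth.slice_a {d : ℕ} {Φ : Y d → ℂ} (h : IsSmooth Φ) (p : Y d) :
    ContDiffAt ℝ ∞ (fun a : Rn d => Φ (p.1, p.2.1, a)) p.2.2 := by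
  have := (h.lift (q := ((p.1 : Rn d), p.2)) (ne_zero_of_mem_unit_sphere p.1)).comp p.2.2
    (f := fun a : Rn d => ((p.1 : Rn d), p.2.1, a))
    (contDiffAt_const.prodMk (contDiffAt_const.prodMk contDiffAt_id))
  simpa [Function.comp_def, DSTFRFT.lift, radial_coe] using this

theorem isRegularOp_partialB {d : ℕ} : IsRegularOp (partialB (d := d)) where
  smooth {Φ} h := by
    have key := isSmooth_of_contDiffAt (d := d)
      (G := fun q => fderiv ℝ (fun t : ℝ => lift Φ (q.1, t, q.2.2)) q.2.1 1) (by
        intro q hq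
        refine ContDiffAt.clm_apply ?_ contDiffAt_const
        refine ContDiffAt.fderiv (n := ∞)
          (f := fun (q : Rn d × ℝ × Rn d) (t : ℝ) => lift Φ (q.1, t, q.2.2)) ?_
          (contDiffAt_fst.comp q contDiffAt_snd) (by norm_num)
        refine (h.lift (q := (q.1, q.2.1, q.2.2)) hq).comp (q, q.2.1)
          (f := fun z : (Rn d × ℝ × Rn d) × ℝ => (z.1.1, z.2, z.1.2.2)) ?_
        fun_prop)
    simp only [DSTFRFT.lift, radial_coe] at key
    exact key
  add {Φ Ψ} h h' := by
    ext p
    have := fderiv_fun_add ((h.slice_b p).differentiableAt (by simp))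
      ((h'.slice_b p).differentiableAt (by simp))
    simp [partialB, this]
  smul c {Φ} h := by
    ext p
    have := fderiv_fun_const_smul ((h.slice_b p).differentiableAt (by simp)) c
    simp only [partialB, Pi.smul_apply, this]
    rfl
  map_conj Φ := by
    ext p
    have := Complex.conjCLE.comp_fderiv (f := fun t : ℝ => Φ (p.1, t, p.2.2)) (x := p.2.1)
    exact congrArg (fun L : ℝ →L[ℝ] ℂ => L 1) this

theorem isRegularOp_partialA {d : ℕ} (j : Fin (d + 1)) : IsRegularOp (partialA (d := d) j) where
  smooth {Φ} h := by
    have key := isSmooth_of_contDiffAt (d := d)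
      (G := fun q => fderiv ℝ (fun a : Rn d => lift Φ (q.1, q.2.1, a)) q.2.2
        (EuclideanSpace.single j 1)) (by
        intro q hq
        refine ContDiffAt.clm_apply ?_ contDiffAt_const
        refine ContDiffAt.fderiv (n := ∞)
          (f := fun (q : Rn d × ℝ × Rn d) (a : Rn d) => lift Φ (q.1, q.2.1, a)) ?_
          (contDiffAt_snd.comp q contDiffAt_snd) (by norm_num)
        refine (h.lift (q := (q.1, q.2.1, q.2.2)) hq).comp (q, q.2.2)
          (f := fun z : (Rn d × ℝ × Rn d) × Rn d => (z.1.1, z.1.2.1, z.2)) ?_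
        fun_prop)
    simp only [DSTFRFT.lift, radial_coe] at key
    exact key
  add {Φ Ψ} h h' := by
    ext p
    have := fderiv_fun_add ((h.slice_a p).differentiableAt (by simp))
      ((h'.slice_a p).differentiableAt (by simp))
    simp [partialA, this]
  smul c {Φ} h := by
    ext p
    have := fderiv_fun_const_smul ((h.slice_a p).differentiableAt (by simp)) c
    simp only [partialA, Pi.smul_apply, this]
    rfl
  map_conj Φ := by
    ext p
    have := Complex.conjCLE.comp_fderiv (f := fun a : Rn d => Φ (p.1, p.2.1, a)) (x := p.2.2)
    exact congrArg (fun L : Rn d →L[ℝ] ℂ => L (EuclideanSpace.single j 1)) this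

theorem isRegularOp_sphLaplacian {d : ℕ} : IsRegularOp (sphLaplacian (d := d)) where
  smooth {Φ} h := by
    have key := isSmooth_of_contDiffAt (d := d)
      (G := fun q => ∑ i, fderiv ℝ (fun y : Rn d =>
        fderiv ℝ (fun x : Rn d => lift Φ (x, q.2)) y) q.1
          (EuclideanSpace.basisFun (Fin (d + 1)) ℝ i)
          (EuclideanSpace.basisFun (Fin (d + 1)) ℝ i)) (by
        intro q hq
        refine ContDiffAt.sum fun i _ => ?_
        refine ContDiffAt.clm_apply (ContDiffAt.clm_apply ?_ contDiffAt_const) contDiffAt_const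
        refine ContDiffAt.fderiv (n := ∞)
          (f := fun (q : Rn d × ℝ × Rn d) (y : Rn d) =>
            fderiv ℝ (fun x : Rn d => lift Φ (x, q.2)) y) ?_ contDiffAt_fst (by norm_num)
        refine ContDiffAt.fderiv (n := ∞)
          (f := fun (z : (Rn d × ℝ × Rn d) × Rn d) (x : Rn d) => lift Φ (x, z.1.2)) ?_
          contDiffAt_snd (by norm_num)
        refine (h.lift (q := (q.1, q.2)) hq).comp ((q, q.1), q.1)
          (f := fun w : ((Rn d × ℝ × Rn d) × Rn d) × Rn d => (w.2, w.1.1.2)) ?_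
        fun_prop)
    convert key using 1
    ext p
    simp only [sphLaplacian]
    rw [InnerProductSpace.laplacian_eq_iteratedFDeriv_orthonormalBasis _
      (EuclideanSpace.basisFun (Fin (d + 1)) ℝ)]
    simp [iteratedFDeriv_two_apply, DSTFRFT.lift]
  add {Φ Ψ} h h' := by
    ext p
    exact ContDiffAt.laplacian_add ((h.slice_radial p).of_le (ENat.LEInfty.out))
      ((h'.slice_radial p).of_le (ENat.LEInfty.out))
  smul c {Φ} h := by
    ext p
    exact InnerProductSpace.laplacian_smul c ((h.slice_radial p).of_le (ENat.LEInfty.out))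
  map_conj Φ := by
    ext p
    exact congrFun (InnerProductSpace.laplacian_CLE_comp_left
      (f := fun x : Rn d => Φ (radial x, p.2)) (l := Complex.conjCLE)) (p.1 : Rn d)

theorem isRegularOp_mixedDeriv {d : ℕ} (m k : ℕ) (l : Fin (d + 1) → ℕ) :
    IsRegularOp (mixedDeriv (d := d) m k l) := by
  have h : ∀ L : List (Fin (d + 1)),
      IsRegularOp (L.foldr (fun j T => (partialA (d := d) j)^[l j] ∘ T) id) := by
    intro L
    induction L with
    | nil => exact IsRegularOp.id
    | cons j L ih => exact ((isRegularOp_partialA j).iterate _).comp ih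
  exact (h _).comp ((isRegularOp_partialB.iterate m).comp (isRegularOp_sphLaplacian.iterate k))

theorem weighted_nonneg {d : ℕ} (s r m k : ℕ) (l : Fin (d + 1) → ℕ) (Φ : Y d → ℂ) (p : Y d) :
    0 ≤ weighted s r m k l Φ p := by
  unfold weighted
  positivity

theorem weighted_add_le {d : ℕ} (s r m k : ℕ) (l : Fin (d + 1) → ℕ) {Φ Ψ : Y d → ℂ}
    (h : IsSmooth Φ) (h' : IsSmooth Ψ) (p : Y d) :
    weighted s r m k l (Φ + Ψ) p ≤ weighted s r m k l Φ p + weighted s r m k l Ψ p := by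
  unfold weighted
  rw [(isRegularOp_mixedDeriv m k l).add h h', ← mul_add]
  exact mul_le_mul_of_nonneg_left (norm_add_le _ _) (by positivity)

theorem weighted_smul {d : ℕ} (s r m k : ℕ) (l : Fin (d + 1) → ℕ) (c : ℂ) {Φ : Y d → ℂ}
    (h : IsSmooth Φ) (p : Y d) :
    weighted s r m k l (c • Φ) p = ‖c‖ * weighted s r m k l Φ p := by
  unfold weighted
  rw [(isRegularOp_mixedDeriv m k l).smul c h, Pi.smul_apply, norm_smul]
  ring

theorem weighted_conj {d : ℕ} (s r m k : ℕ) (l : Fin (d + 1) → ℕ) (Φ : Y d → ℂ) (p : Y d) :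
    weighted s r m k l (fun q => conj (Φ q)) p = weighted s r m k l Φ p := by
  unfold weighted
  rw [(isRegularOp_mixedDeriv m k l).map_conj, RCLike.norm_conj]

/-! ### The space `𝒮(𝕐²ⁿ)` -/

/-- The smooth functions on `𝕐²ⁿ` all of whose quantities
`sup (1+|b|²)^{r/2} (1+|a|²)^{s/2} |∂_a^l ∂_b^m Δ_u^k Φ|` are finite. -/
def schwartzSubmodule (d : ℕ) : Submodule ℂ (Y d → ℂ) where
  carrier := {Φ | IsSmooth Φ ∧ ∀ (s r m k : ℕ) (l : Fin (d + 1) → ℕ),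
    BddAbove (Set.range (weighted s r m k l Φ))}
  add_mem' := by
    rintro Φ Ψ ⟨h1, h2⟩ ⟨h1', h2'⟩
    refine ⟨h1.add h1', fun s r m k l => ?_⟩
    obtain ⟨C, hC⟩ := h2 s r m k l
    obtain ⟨C', hC'⟩ := h2' s r m k l
    refine ⟨C + C', ?_⟩
    rintro _ ⟨p, rfl⟩
    exact (weighted_add_le s r m k l h1 h1' p).trans
      (add_le_add (hC ⟨p, rfl⟩) (hC' ⟨p, rfl⟩))
  zero_mem' := by
    have h0 : IsSmooth (0 : Y d → ℂ) := contMDiff_const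
    refine ⟨h0, fun s r m k l => ⟨0, ?_⟩⟩
    rintro _ ⟨p, rfl⟩
    have := weighted_smul s r m k l 0 h0 p
    simp only [zero_smul, norm_zero, zero_mul] at this
    exact this.le
  smul_mem' := by
    rintro c Φ ⟨h1, h2⟩
    refine ⟨h1.smul c, fun s r m k l => ?_⟩
    obtain ⟨C, hC⟩ := h2 s r m k l
    refine ⟨‖c‖ * C, ?_⟩
    rintro _ ⟨p, rfl⟩
    rw [weighted_smul s r m k l c h1 p]
    exact mul_le_mul_of_nonneg_left (hC ⟨p, rfl⟩) (norm_nonneg c)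

/-- The space `𝒮(𝕐²ⁿ)`. (A type of its own, so that it does not carry the topology of pointwise
convergence.) -/
def SchwartzY (d : ℕ) : Type := schwartzSubmodule d

namespace SchwartzY

instance (d : ℕ) : AddCommGroup (SchwartzY d) :=
  inferInstanceAs (AddCommGroup (schwartzSubmodule d))

instance (d : ℕ) : Module ℂ (SchwartzY d) :=
  inferInstanceAs (Module ℂ (schwartzSubmodule d))

/-- The underlying function of an element of `𝒮(𝕐²ⁿ)`. -/
def toFun {d : ℕ} (Φ : SchwartzY d) : Y d → ℂ := Φ.1

instance (d : ℕ) : CoeFun (SchwartzY d) (fun _ => Y d → ℂ) := ⟨toFun⟩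

theorem isSmooth {d : ℕ} (Φ : SchwartzY d) : IsSmooth (Φ : Y d → ℂ) := Φ.2.1

theorem bddAbove {d : ℕ} (Φ : SchwartzY d) (s r m k : ℕ) (l : Fin (d + 1) → ℕ) :
    BddAbove (Set.range (weighted s r m k l Φ)) := Φ.2.2 s r m k l

/-- The seminorm `ρ_{s,r}^{l,m,k}` on `𝒮(𝕐²ⁿ)`. -/
protected def seminorm {d : ℕ} (s r m k : ℕ) (l : Fin (d + 1) → ℕ) : Seminorm ℂ (SchwartzY d) :=
  Seminorm.of (fun Φ => ⨆ p : Y d, weighted s r m k l Φ p)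
    (by
      intro Φ Ψ
      have : Nonempty (Y d) := ⟨(pole d, 0, 0)⟩
      refine ciSup_le fun p => ?_
      exact (weighted_add_le s r m k l Φ.isSmooth Ψ.isSmooth p).trans
        (add_le_add (le_ciSup (Φ.bddAbove s r m k l) p) (le_ciSup (Ψ.bddAbove s r m k l) p)))
    (by
      intro c Φ
      rw [Real.mul_iSup_of_nonneg (norm_nonneg c)]
      exact iSup_congr fun p => weighted_smul s r m k l c Φ.isSmooth p)

/-- The family of all seminorms `ρ_{s,r}^{l,m,k}`, indexed by `(s, r, m, k, l)`. -/
def seminormFamily (d : ℕ) :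
    SeminormFamily ℂ (SchwartzY d) (ℕ × ℕ × ℕ × ℕ × (Fin (d + 1) → ℕ)) :=
  fun i => SchwartzY.seminorm i.1 i.2.1 i.2.2.1 i.2.2.2.1 i.2.2.2.2

instance (d : ℕ) : TopologicalSpace (SchwartzY d) :=
  (seminormFamily d).moduleFilterBasis.topology'

theorem withSeminorms (d : ℕ) : WithSeminorms (seminormFamily d) := ⟨rfl⟩

instance (d : ℕ) : IsTopologicalAddGroup (SchwartzY d) :=
  (withSeminorms d).topologicalAddGroup

instance (d : ℕ) : ContinuousSMul ℂ (SchwartzY d) :=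
  (withSeminorms d).continuousSMul

/-- Complex conjugation on `𝒮(𝕐²ⁿ)`. -/
def conjugate {d : ℕ} (Φ : SchwartzY d) : SchwartzY d :=
  ⟨fun p => conj (Φ p), Φ.isSmooth.conjugate, fun s r m k l => by
    have h : weighted s r m k l (fun p => conj (Φ p)) = weighted s r m k l Φ :=
      funext (weighted_conj s r m k l Φ)
    rw [h]
    exact Φ.bddAbove s r m k l⟩

end SchwartzY

/-- Complex conjugation on `𝒮(ℝⁿ)`. -/
def schwartzConj {d : ℕ} (φ : 𝓢(Rn d, ℂ)) : 𝓢(Rn d, ℂ) :=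
  SchwartzMap.postcompCLM (Complex.conjCLE : ℂ →L[ℝ] ℂ) φ

/-- `𝒮'(ℝⁿ)`: the continuous dual with the strong topology, that is, uniform convergence on
bounded sets (Mathlib's topology on continuous linear maps). -/
abbrev TemperedDual (d : ℕ) : Type := 𝓢(Rn d, ℂ) →L[ℂ] ℂ

/-- `𝒮'(𝕐²ⁿ)`: the continuous dual with the strong topology. -/
abbrev TemperedDualY (d : ℕ) : Type := SchwartzY d →L[ℂ] ℂ

end DSTFRFT

end

/-! Up to a constant factor the kernel is exp(i · phase) with a real quadratic phase, so its modulus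
is constant. Both transforms integrate against the same oscillating ridge function χ(⟨w, x⟩ - b)
K(x, a): the analysis transform over x, with χ the conjugate of ψ and angles α; the synthesis
transform over (u, b, a), with χ = ψ and angles -α. Absolute values alone bound either transform by
a continuous seminorm of its argument, uniformly in the point. All decay and smoothness then follows
because every weight and every derivative can be absorbed into further transforms of the same kind.

A derivative either turns χ into χ' or brings down a factor linear in the coordinates. A factor b is
written ⟨u, x⟩ - (⟨u, x⟩ - b): the first term multiplies φ by coordinates of x, the second
multiplies the window by its own variable. A factor a_k (for analysis) or x_k (for synthesis) comes
from integration by parts in the dual variable: ∂_{x_k} of the phase is x_k cot α_k - a_k / sin α_k,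
which can be solved for a_k since sin α_k ≠ 0, and the phase is symmetric in x and a.

These rules are organised as inductively defined classes, `AnalysisFamily` on one side,
`CoefficientFamily` and `SynthesisFamily` on the other, closed under the required operations. Each
`isDominated` lemma is the crude bound; closure upgrades it to all the seminorms in
`AnalysisFamily.isDominated_weighted` and `SynthesisFamily.isDominated_iteratedFDeriv`. The
Laplace–Beltrami operator enters as a sum of squares of first-order derivatives
(`sphLaplacian_eq_sum`).

On the dual spaces, conjugating before and after makes each transform ℂ-linear and continuous again.
The extended maps are the transposes, which are continuous for the strong topologies because
continuous linear maps send bounded sets to bounded sets. -/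

noncomputable section

namespace DSTFRFT

/-! ### The kernel as a unimodular oscillation -/

/-- The real phase of the fractional Fourier kernel. -/
def phase {d : ℕ} (α : Fin (d + 1) → ℝ) (x ξ : Rn d) : ℝ :=
  ∑ k, ((x k ^ 2 + ξ k ^ 2) / 2 * Real.cot (α k) - x k * ξ k * (Real.sin (α k))⁻¹)

/-- The constant factor of the fractional Fourier kernel. -/
def kernelConst {d : ℕ} (α : Fin (d + 1) → ℝ) : ℂ :=
  ∏ k, ((1 - Complex.I * (Real.cot (α k) : ℂ)) / (2 * (Real.pi : ℂ))) ^ (1 / 2 : ℂ)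

/-- The derivative of the phase in the first variable, in the direction `v`. -/
def phaseGrad {d : ℕ} (α : Fin (d + 1) → ℝ) (x ξ v : Rn d) : ℝ :=
  ∑ k, (x k * Real.cot (α k) - ξ k * (Real.sin (α k))⁻¹) * v k

theorem kernel_eq {d : ℕ} (α : Fin (d + 1) → ℝ) (x ξ : Rn d) :
    kernel α x ξ = kernelConst α * Complex.exp (Complex.I * (phase α x ξ : ℂ)) := by
  simp only [kernel, kernelOne, kernelConst, phase, Finset.prod_mul_distrib, ← Complex.exp_sum,
    Complex.ofReal_sum, Finset.mul_sum]

/-- The phase is real. This constant modulus is all that the absolute estimates use about the size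
of the kernel. -/
theorem norm_kernel {d : ℕ} (α : Fin (d + 1) → ℝ) (x ξ : Rn d) :
    ‖kernel α x ξ‖ = ‖kernelConst α‖ := by
  rw [kernel_eq, norm_mul, mul_comm Complex.I, Complex.norm_exp_ofReal_mul_I, mul_one]

theorem phaseGrad_single {d : ℕ} (α : Fin (d + 1) → ℝ) (x ξ : Rn d) (k : Fin (d + 1)) :
    phaseGrad α x ξ (EuclideanSpace.single k 1) =
      x k * Real.cot (α k) - ξ k * (Real.sin (α k))⁻¹ := by
  simp [phaseGrad]

theorem phaseGrad_zero {d : ℕ} (α : Fin (d + 1) → ℝ) (x ξ : Rn d) :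
    phaseGrad α x ξ 0 = 0 := by
  simp [phaseGrad]

theorem abs_phaseGrad_le {d : ℕ} (α : Fin (d + 1) → ℝ) (x ξ v : Rn d) :
    |phaseGrad α x ξ v| ≤
      (∑ k, (|Real.cot (α k)| + |(Real.sin (α k))⁻¹|)) * (‖x‖ + ‖ξ‖) * ‖v‖ := by
  unfold phaseGrad
  refine (Finset.abs_sum_le_sum_abs _ _).trans ?_
  rw [Finset.sum_mul, Finset.sum_mul]
  refine Finset.sum_le_sum fun k _ => ?_
  rw [abs_mul]
  have hx : |x k| ≤ ‖x‖ := PiLp.norm_apply_le x k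
  have hξ : |ξ k| ≤ ‖ξ‖ := PiLp.norm_apply_le ξ k
  have hv : |v k| ≤ ‖v‖ := PiLp.norm_apply_le v k
  refine mul_le_mul ?_ hv (abs_nonneg _) (by positivity)
  refine (abs_sub _ _).trans ?_
  rw [abs_mul, abs_mul]
  nlinarith [abs_nonneg (Real.cot (α k)), abs_nonneg (Real.sin (α k))⁻¹, norm_nonneg x,
    norm_nonneg ξ, mul_le_mul_of_nonneg_right hx (abs_nonneg (Real.cot (α k))),
    mul_le_mul_of_nonneg_right hξ (abs_nonneg (Real.sin (α k))⁻¹),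
    mul_nonneg (norm_nonneg ξ) (abs_nonneg (Real.cot (α k))),
    mul_nonneg (norm_nonneg x) (abs_nonneg (Real.sin (α k))⁻¹)]

theorem contDiff_kernel {d : ℕ} (α : Fin (d + 1) → ℝ) :
    ContDiff ℝ ∞ (fun z : Rn d × Rn d => kernel α z.1 z.2) := by
  have h1 (k : Fin (d + 1)) : ContDiff ℝ ∞ (fun z : Rn d × Rn d => z.1 k) :=
    (EuclideanSpace.proj (𝕜 := ℝ) k).contDiff.comp contDiff_fst
  have h2 (k : Fin (d + 1)) : ContDiff ℝ ∞ (fun z : Rn d × Rn d => z.2 k) :=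
    (EuclideanSpace.proj (𝕜 := ℝ) k).contDiff.comp contDiff_snd
  have h : ContDiff ℝ ∞ (fun z : Rn d × Rn d => phase α z.1 z.2) :=
    ContDiff.sum fun k _ => (((((h1 k).pow 2).add ((h2 k).pow 2)).div_const 2).mul
      contDiff_const).sub (((h1 k).mul (h2 k)).mul contDiff_const)
  simp only [kernel_eq]
  exact contDiff_const.mul (ContDiff.cexp (contDiff_const.mul
    (Complex.ofRealCLM.contDiff.comp h)))

/-- The phase is symmetric in its two arguments, so one gradient with swapped arguments serves both
directions. -/
theorem hasDerivAt_phase {d : ℕ} (α : Fin (d + 1) → ℝ) (x ξ v w : Rn d) :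
    HasDerivAt (fun t : ℝ => phase α (x + t • v) (ξ + t • w))
      (phaseGrad α x ξ v + phaseGrad α ξ x w) 0 := by
  simp only [phase, phaseGrad, ← Finset.sum_add_distrib]
  refine HasDerivAt.fun_sum fun k _ => ?_
  have h1 : HasDerivAt (fun t : ℝ => (x + t • v) k) (v k) 0 := by
    simpa using ((hasDerivAt_id (0 : ℝ)).mul_const (v k)).const_add (x k)
  have h2 : HasDerivAt (fun t : ℝ => (ξ + t • w) k) (w k) 0 := by
    simpa using ((hasDerivAt_id (0 : ℝ)).mul_const (w k)).const_add (ξ k)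
  have h := ((((h1.pow 2).add (h2.pow 2)).div_const 2).mul_const (Real.cot (α k))).sub
    ((h1.mul h2).mul_const (Real.sin (α k))⁻¹)
  refine h.congr_deriv ?_
  simp
  ring

theorem hasDerivAt_kernel {d : ℕ} (α : Fin (d + 1) → ℝ) (x ξ v w : Rn d) :
    HasDerivAt (fun t : ℝ => kernel α (x + t • v) (ξ + t • w))
      (kernel α x ξ * (Complex.I * ((phaseGrad α x ξ v + phaseGrad α ξ x w : ℝ) : ℂ))) 0 := by
  simp only [kernel_eq]
  have h := (((hasDerivAt_phase α x ξ v w).ofReal_comp.const_mul Complex.I).cexp).const_mul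
    (kernelConst α)
  refine h.congr_deriv ?_
  simp
  ring

/-! ### Oscillating ridge functions -/

/-- The oscillating ridge function `χ(⟨w, x⟩ - b) K_α(x, a)`, `q = (w, b, a)`. -/
def ridge {d : ℕ} (α : Fin (d + 1) → ℝ) (χ : 𝓢(ℝ, ℂ)) (x : Rn d) (q : Rn d × ℝ × Rn d) : ℂ :=
  χ (inner ℝ q.1 x - q.2.1) * kernel α x q.2.2

theorem contDiff_ridge {d : ℕ} (α : Fin (d + 1) → ℝ) (χ : 𝓢(ℝ, ℂ)) :
    ContDiff ℝ ∞ (fun z : Rn d × Rn d × ℝ × Rn d => ridge α χ z.1 z.2) := by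
  have h1 : ContDiff ℝ ∞ (fun z : Rn d × Rn d × ℝ × Rn d => inner ℝ z.2.1 z.1 - z.2.2.1) :=
    (ContDiff.inner ℝ (contDiff_fst.comp contDiff_snd) contDiff_fst).sub
      (contDiff_fst.comp (contDiff_snd.comp contDiff_snd))
  have h2 : ContDiff ℝ ∞ (fun z : Rn d × Rn d × ℝ × Rn d => (z.1, z.2.2.2)) :=
    contDiff_fst.prodMk (contDiff_snd.comp (contDiff_snd.comp contDiff_snd))
  have h3 : ContDiff ℝ ∞ χ := χ.smooth ⊤
  have h4 : ContDiff ℝ ∞ (fun z : Rn d × Rn d × ℝ × Rn d => χ (inner ℝ z.2.1 z.1 - z.2.2.1)) :=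
    h3.comp h1
  have h5 : ContDiff ℝ ∞ (fun z : Rn d × Rn d × ℝ × Rn d => kernel α z.1 z.2.2.2) :=
    ContDiff.comp (g := fun z : Rn d × Rn d => kernel α z.1 z.2)
      (f := fun z : Rn d × Rn d × ℝ × Rn d => (z.1, z.2.2.2)) (contDiff_kernel α) h2
  exact h4.mul h5

theorem contDiff_ridge_left {d : ℕ} (α : Fin (d + 1) → ℝ) (χ : 𝓢(ℝ, ℂ))
    (q : Rn d × ℝ × Rn d) : ContDiff ℝ ∞ (fun x => ridge α χ x q) :=
  (contDiff_ridge α χ).comp (f := fun x => (x, q)) (contDiff_id.prodMk contDiff_const)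

theorem contDiff_ridge_right {d : ℕ} (α : Fin (d + 1) → ℝ) (χ : 𝓢(ℝ, ℂ)) (x : Rn d) :
    ContDiff ℝ ∞ (ridge α χ x) :=
  (contDiff_ridge α χ).comp (f := fun q => (x, q)) (contDiff_const.prodMk contDiff_id)

theorem norm_ridge_le {d : ℕ} (α : Fin (d + 1) → ℝ) (χ : 𝓢(ℝ, ℂ)) (x : Rn d)
    (q : Rn d × ℝ × Rn d) :
    ‖ridge α χ x q‖ ≤ SchwartzMap.seminorm ℝ 0 0 χ * ‖kernelConst α‖ := by
  rw [ridge, norm_mul, norm_kernel]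
  exact mul_le_mul_of_nonneg_right (χ.norm_le_seminorm ℝ _) (norm_nonneg _)

/-- The derivative of `ridge` in the direction `(v, w)`. -/
def ridgeDeriv {d : ℕ} (α : Fin (d + 1) → ℝ) (χ : 𝓢(ℝ, ℂ)) (x : Rn d) (q : Rn d × ℝ × Rn d)
    (v : Rn d) (w : Rn d × ℝ × Rn d) : ℂ :=
  ((inner ℝ w.1 x + inner ℝ q.1 v - w.2.1 : ℝ) : ℂ) *
      ridge α (SchwartzMap.derivCLM ℂ ℂ χ) x q +
    Complex.I * ((phaseGrad α x q.2.2 v + phaseGrad α q.2.2 x w.2.2 : ℝ) : ℂ) * ridge α χ x q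

/-- One product-rule computation in all variables at once; the derivatives used for analysis (`v =
0`) and for synthesis (`w = 0`) are its specialisations. -/
theorem hasDerivAt_ridge {d : ℕ} (α : Fin (d + 1) → ℝ) (χ : 𝓢(ℝ, ℂ)) (x : Rn d)
    (q : Rn d × ℝ × Rn d) (v : Rn d) (w : Rn d × ℝ × Rn d) :
    HasDerivAt (fun t : ℝ => ridge α χ (x + t • v) (q + t • w)) (ridgeDeriv α χ x q v w) 0 := by
  have h1 : HasDerivAt (fun t : ℝ => inner ℝ (q + t • w).1 (x + t • v) - (q + t • w).2.1)
      (inner ℝ w.1 x + inner ℝ q.1 v - w.2.1) 0 := by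
    have hx : HasDerivAt (fun t : ℝ => x + t • v) v 0 := by
      simpa using ((hasDerivAt_id (0 : ℝ)).smul_const v).const_add x
    have hq : HasDerivAt (fun t : ℝ => q.1 + t • w.1) w.1 0 := by
      simpa using ((hasDerivAt_id (0 : ℝ)).smul_const w.1).const_add q.1
    have hb : HasDerivAt (fun t : ℝ => q.2.1 + t * w.2.1) w.2.1 0 := by
      simpa using ((hasDerivAt_id (0 : ℝ)).mul_const w.2.1).const_add q.2.1
    refine ((hq.inner ℝ hx).sub hb).congr_deriv ?_
    simp [add_comm]
  have h2 := (χ.hasDerivAt (inner ℝ q.1 x - q.2.1)).scomp_of_eq (0 : ℝ) h1 (by simp)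
  refine (h2.mul (hasDerivAt_kernel α x q.2.2 v w.2.2)).congr_deriv ?_
  simp only [ridgeDeriv, ridge, SchwartzMap.derivCLM_apply, Complex.real_smul, Function.comp_apply]
  simp
  ring

theorem fderiv_ridge_right {d : ℕ} (α : Fin (d + 1) → ℝ) (χ : 𝓢(ℝ, ℂ)) (x : Rn d)
    (q w : Rn d × ℝ × Rn d) :
    fderiv ℝ (ridge α χ x) q w = ridgeDeriv α χ x q 0 w := by
  rw [← ((contDiff_ridge_right α χ x).differentiable (by simp) q).lineDeriv_eq_fderiv]
  have h := hasDerivAt_ridge α χ x q 0 w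
  simp only [smul_zero, add_zero] at h
  exact HasLineDerivAt.lineDeriv h

theorem fderiv_ridge_left {d : ℕ} (α : Fin (d + 1) → ℝ) (χ : 𝓢(ℝ, ℂ)) (x v : Rn d)
    (q : Rn d × ℝ × Rn d) :
    fderiv ℝ (fun x => ridge α χ x q) x v = ridgeDeriv α χ x q v 0 := by
  rw [← ((contDiff_ridge_left α χ q).differentiable (by simp) x).lineDeriv_eq_fderiv]
  have h := hasDerivAt_ridge α χ x q v 0
  simp only [smul_zero, add_zero] at h
  exact HasLineDerivAt.lineDeriv h

/-- Differentiation costs only linear growth, which a rapidly decreasing factor absorbs. This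
supplies the majorants for differentiating under both integrals. -/
theorem exists_norm_ridgeDeriv_le {d : ℕ} (α : Fin (d + 1) → ℝ) (χ : 𝓢(ℝ, ℂ)) :
    ∃ C, 0 ≤ C ∧ ∀ (x : Rn d) (q : Rn d × ℝ × Rn d) (v : Rn d) (w : Rn d × ℝ × Rn d),
      ‖ridgeDeriv α χ x q v w‖ ≤ C * (1 + ‖x‖ + ‖q‖) * (‖v‖ + ‖w‖) := by
  set C₁ := SchwartzMap.seminorm ℝ 0 0 (SchwartzMap.derivCLM ℂ ℂ χ) * ‖kernelConst α‖
  set C₂ := SchwartzMap.seminorm ℝ 0 0 χ * ‖kernelConst α‖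
  set M := ∑ k, (|Real.cot (α k)| + |(Real.sin (α k))⁻¹|)
  have hC₁ : 0 ≤ C₁ := by positivity
  have hC₂ : 0 ≤ C₂ := by positivity
  have hM : 0 ≤ M := Finset.sum_nonneg fun _ _ => by positivity
  refine ⟨C₁ + M * C₂, by positivity, fun x q v w => ?_⟩
  have hq1 : ‖q.1‖ ≤ ‖q‖ := norm_fst_le q
  have hq3 : ‖q.2.2‖ ≤ ‖q‖ := (norm_snd_le q.2).trans (norm_snd_le q)
  have hw1 : ‖w.1‖ ≤ ‖w‖ := norm_fst_le w
  have hw2 : |w.2.1| ≤ ‖w‖ := (norm_fst_le w.2).trans (norm_snd_le w)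
  have hw3 : ‖w.2.2‖ ≤ ‖w‖ := (norm_snd_le w.2).trans (norm_snd_le w)
  have h1 : |inner ℝ w.1 x + inner ℝ q.1 v - w.2.1| ≤ (1 + ‖x‖ + ‖q‖) * (‖v‖ + ‖w‖) := by
    calc _ ≤ |inner ℝ w.1 x| + |inner ℝ q.1 v| + |w.2.1| :=
          (abs_sub _ _).trans (by gcongr; exact abs_add_le _ _)
      _ ≤ ‖w‖ * ‖x‖ + ‖q‖ * ‖v‖ + ‖w‖ := by
          gcongr
          · exact (abs_real_inner_le_norm _ _).trans (by gcongr)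
          · exact (abs_real_inner_le_norm _ _).trans (by gcongr)
      _ ≤ _ := by
          have : 0 ≤ ‖v‖ + ‖x‖ * ‖v‖ + ‖q‖ * ‖w‖ := by positivity
          linarith
  have h2 : |phaseGrad α x q.2.2 v + phaseGrad α q.2.2 x w.2.2| ≤
      M * ((1 + ‖x‖ + ‖q‖) * (‖v‖ + ‖w‖)) := by
    calc _ ≤ M * (‖x‖ + ‖q.2.2‖) * ‖v‖ + M * (‖q.2.2‖ + ‖x‖) * ‖w.2.2‖ :=
          (abs_add_le _ _).trans (add_le_add (abs_phaseGrad_le _ _ _ _)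
            (abs_phaseGrad_le _ _ _ _))
      _ ≤ M * (‖x‖ + ‖q‖) * ‖v‖ + M * (‖q‖ + ‖x‖) * ‖w‖ := by gcongr
      _ = M * ((0 + ‖x‖ + ‖q‖) * (‖v‖ + ‖w‖)) := by ring
      _ ≤ _ := by gcongr; exact zero_le_one
  unfold ridgeDeriv
  calc _ ≤ |inner ℝ w.1 x + inner ℝ q.1 v - w.2.1| * C₁ +
        |phaseGrad α x q.2.2 v + phaseGrad α q.2.2 x w.2.2| * C₂ := by
        refine (norm_add_le _ _).trans ?_
        rw [norm_mul, norm_mul, norm_mul, Complex.norm_I, one_mul, Complex.norm_real,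
          Complex.norm_real]
        exact add_le_add (mul_le_mul_of_nonneg_left (norm_ridge_le _ _ _ _) (abs_nonneg _))
          (mul_le_mul_of_nonneg_left (norm_ridge_le _ _ _ _) (abs_nonneg _))
    _ ≤ ((1 + ‖x‖ + ‖q‖) * (‖v‖ + ‖w‖)) * C₁ + M * ((1 + ‖x‖ + ‖q‖) * (‖v‖ + ‖w‖)) * C₂ := by
        gcongr
    _ = _ := by ring

/-- Multiplication by the coordinate on `𝒮(ℝ)`. -/
def mulCoord : 𝓢(ℝ, ℂ) →L[ℂ] 𝓢(ℝ, ℂ) := SchwartzMap.smulLeftCLM ℂ (fun t : ℝ => (t : ℂ))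

theorem mulCoord_apply (χ : 𝓢(ℝ, ℂ)) (t : ℝ) : mulCoord χ t = t * χ t := by
  rw [mulCoord, SchwartzMap.smulLeftCLM_apply_apply (by fun_prop), smul_eq_mul]

theorem ofReal_inner_eq_sum {d : ℕ} (w x : Rn d) :
    ((inner ℝ w x : ℝ) : ℂ) = ∑ k, (w k : ℂ) * (x k : ℂ) := by
  simp [PiLp.inner_apply, mul_comm]

/-- Write b = ⟨w, x⟩ - (⟨w, x⟩ - b); the second term is the argument of the window. -/
theorem coord_mul_ridge {d : ℕ} (α : Fin (d + 1) → ℝ) (χ : 𝓢(ℝ, ℂ)) (x : Rn d)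
    (q : Rn d × ℝ × Rn d) :
    (q.2.1 : ℂ) * ridge α χ x q =
      (∑ k, (q.1 k : ℂ) * (x k : ℂ)) * ridge α χ x q - ridge α (mulCoord χ) x q := by
  simp only [ridge, mulCoord_apply, ← ofReal_inner_eq_sum]
  push_cast
  ring

/-! ### Linearity of integrals -/

/-- `f` is integrable with integral `I`. -/
structure HasIntegral {X : Type*} [MeasurableSpace X] (μ : MeasureTheory.Measure X) (f : X → ℂ)
    (I : ℂ) : Prop where
  integrable : MeasureTheory.Integrable f μ
  eq : ∫ x, f x ∂μ = I

namespace HasIntegral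

variable {X : Type*} [MeasurableSpace X] {μ : MeasureTheory.Measure X} {f g : X → ℂ} {I J : ℂ}

theorem add (hf : HasIntegral μ f I) (hg : HasIntegral μ g J) :
    HasIntegral μ (fun x => f x + g x) (I + J) :=
  ⟨hf.1.add hg.1, by rw [MeasureTheory.integral_add hf.1 hg.1, hf.2, hg.2]⟩

theorem sub (hf : HasIntegral μ f I) (hg : HasIntegral μ g J) :
    HasIntegral μ (fun x => f x - g x) (I - J) :=
  ⟨hf.1.sub hg.1, by rw [MeasureTheory.integral_sub hf.1 hg.1, hf.2, hg.2]⟩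

theorem const_mul (c : ℂ) (hf : HasIntegral μ f I) : HasIntegral μ (fun x => c * f x) (c * I) :=
  ⟨hf.1.const_mul c, by rw [MeasureTheory.integral_const_mul, hf.2]⟩

theorem sum {ι : Type*} (s : Finset ι) {f : ι → X → ℂ} {I : ι → ℂ}
    (h : ∀ i ∈ s, HasIntegral μ (f i) (I i)) :
    HasIntegral μ (fun x => ∑ i ∈ s, f i x) (∑ i ∈ s, I i) :=
  ⟨MeasureTheory.integrable_finsetSum _ fun i hi => (h i hi).1, by
    rw [MeasureTheory.integral_finsetSum _ fun i hi => (h i hi).1]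
    exact Finset.sum_congr rfl fun i hi => (h i hi).2⟩

end HasIntegral

/-! ### The analysis transform -/

/-- Integration by parts against the constant function 1; integrability replaces compact support. -/
theorem integral_fderiv_eq_zero {E : Type*} [NormedAddCommGroup E] [NormedSpace ℝ E]
    [FiniteDimensional ℝ E] [MeasurableSpace E] [BorelSpace E] {μ : MeasureTheory.Measure E}
    [μ.IsAddHaarMeasure] {f : E → ℂ} (v : E) (hf : Differentiable ℝ f)
    (hfi : MeasureTheory.Integrable f μ)
    (hf' : MeasureTheory.Integrable (fun x => fderiv ℝ f x v) μ) :
    ∫ x, fderiv ℝ f x v ∂μ = 0 := by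
  have h := integral_mul_fderiv_eq_neg_fderiv_mul_of_integrable (𝕜 := ℂ) (μ := μ) (v := v)
    (f := f) (g := fun _ => (1 : ℂ)) (by simpa using hf') (by simp) (by simpa using hfi)
    (fun x _ => hf x) (fun _ _ => differentiableAt_const _)
  simpa using h.symm

/-- Multiplication by the `k`-th coordinate on `𝒮(ℝⁿ)`. -/
def mulX {d : ℕ} (k : Fin (d + 1)) : 𝓢(Rn d, ℂ) →L[ℂ] 𝓢(Rn d, ℂ) :=
  SchwartzMap.smulLeftCLM ℂ (fun x : Rn d => ((x k : ℝ) : ℂ))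

theorem mulX_apply {d : ℕ} (k : Fin (d + 1)) (φ : 𝓢(Rn d, ℂ)) (x : Rn d) :
    mulX k φ x = x k * φ x := by
  have h : Function.HasTemperateGrowth (fun x : Rn d => ((x k : ℝ) : ℂ)) :=
    (Complex.ofRealCLM ∘L EuclideanSpace.proj (𝕜 := ℝ) k).hasTemperateGrowth
  rw [mulX, SchwartzMap.smulLeftCLM_apply_apply h, smul_eq_mul]

/-- The partial derivative in the `k`-th coordinate on `𝒮(ℝⁿ)`. -/
def partialX {d : ℕ} (k : Fin (d + 1)) : 𝓢(Rn d, ℂ) →L[ℂ] 𝓢(Rn d, ℂ) :=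
  LineDeriv.lineDerivOpCLM ℂ 𝓢(Rn d, ℂ) (EuclideanSpace.single k (1 : ℝ))

theorem partialX_apply {d : ℕ} (k : Fin (d + 1)) (φ : 𝓢(Rn d, ℂ)) (x : Rn d) :
    partialX k φ x = fderiv ℝ φ x (EuclideanSpace.single k 1) := rfl

/-- The transform `∫ φ(x) χ(⟨w, x⟩ - b) K_α(x, a) dx` at `q = (w, b, a)`. -/
def analysis {d : ℕ} (α : Fin (d + 1) → ℝ) (χ : 𝓢(ℝ, ℂ)) (φ : 𝓢(Rn d, ℂ))
    (q : Rn d × ℝ × Rn d) : ℂ :=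
  ∫ x, φ x * ridge α χ x q

theorem integrable_mul_ridge {d : ℕ} (α : Fin (d + 1) → ℝ) (χ : 𝓢(ℝ, ℂ)) (φ : 𝓢(Rn d, ℂ))
    (q : Rn d × ℝ × Rn d) : MeasureTheory.Integrable (fun x => φ x * ridge α χ x q) :=
  φ.integrable.mul_bdd (contDiff_ridge_left α χ q).continuous.aestronglyMeasurable
    (.of_forall fun x => norm_ridge_le α χ x q)

theorem hasIntegral_analysis {d : ℕ} (α : Fin (d + 1) → ℝ) (χ : 𝓢(ℝ, ℂ)) (φ : 𝓢(Rn d, ℂ))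
    (q : Rn d × ℝ × Rn d) :
    HasIntegral MeasureTheory.volume (fun x => φ x * ridge α χ x q) (analysis α χ φ q) :=
  ⟨integrable_mul_ridge α χ φ q, rfl⟩

/-- The bound has no decay in q. Decay is obtained later by applying it after the weights have been
absorbed. -/
theorem norm_analysis_le {d : ℕ} (α : Fin (d + 1) → ℝ) (χ : 𝓢(ℝ, ℂ)) (φ : 𝓢(Rn d, ℂ))
    (q : Rn d × ℝ × Rn d) :
    ‖analysis α χ φ q‖ ≤ SchwartzMap.seminorm ℝ 0 0 χ * ‖kernelConst α‖ * ∫ x, ‖φ x‖ := by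
  rw [← MeasureTheory.integral_const_mul]
  refine MeasureTheory.norm_integral_le_of_norm_le (φ.integrable.norm.const_mul _)
    (.of_forall fun x => ?_)
  rw [norm_mul, mul_comm]
  exact mul_le_mul_of_nonneg_right (norm_ridge_le α χ x q) (norm_nonneg _)

/-- Dominated differentiation under the integral. The integrability is recorded as well, because
evaluating the derivative in a direction must be exchanged with the integral. -/
theorem hasFDerivAt_analysis {d : ℕ} (α : Fin (d + 1) → ℝ) (χ : 𝓢(ℝ, ℂ)) (φ : 𝓢(Rn d, ℂ))
    (q : Rn d × ℝ × Rn d) :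
    MeasureTheory.Integrable (fun x => φ x • fderiv ℝ (ridge α χ x) q) ∧
    HasFDerivAt (analysis α χ φ) (∫ x, φ x • fderiv ℝ (ridge α χ x) q) q := by
  obtain ⟨C, hC, hb⟩ := exists_norm_ridgeDeriv_le α χ
  have hcont : ∀ q, Continuous fun x => φ x • fderiv ℝ (ridge α χ x) q := fun q =>
    φ.continuous.smul (ContDiff.continuous (𝕜 := ℝ) (n := ∞)
      (ContDiff.fderiv (f := ridge α χ) (g := fun _ => q) (n := ∞) (contDiff_ridge α χ)
        contDiff_const (by simp)))
  -- On the unit ball ‖q'‖ ≤ 1 + ‖q‖, so 1 + ‖x‖ + ‖q'‖ ≤ (2 + ‖q‖) + ‖x‖.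
  have hbound : ∀ x, ∀ q' ∈ Metric.ball q 1, ‖φ x • fderiv ℝ (ridge α χ x) q'‖ ≤
      C * ((2 + ‖q‖) * ‖φ x‖ + ‖x‖ ^ 1 * ‖φ x‖) := by
    intro x q' hq'
    have hq'' : ‖q'‖ ≤ 1 + ‖q‖ := by
      have h := norm_le_norm_add_norm_sub' q' q
      rw [mem_ball_iff_norm] at hq'
      linarith
    have h1 : ‖fderiv ℝ (ridge α χ x) q'‖ ≤ C * (1 + ‖x‖ + ‖q'‖) := by
      refine ContinuousLinearMap.opNorm_le_bound _ (by positivity) fun w => ?_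
      rw [fderiv_ridge_right]
      simpa using hb x q' 0 w
    rw [norm_smul]
    calc ‖φ x‖ * ‖fderiv ℝ (ridge α χ x) q'‖ ≤ ‖φ x‖ * (C * (1 + ‖x‖ + (1 + ‖q‖))) := by
          gcongr
          exact h1.trans (by gcongr)
      _ = _ := by ring
  have hint : MeasureTheory.Integrable
      (fun x => C * ((2 + ‖q‖) * ‖φ x‖ + ‖x‖ ^ 1 * ‖φ x‖)) :=
    ((φ.integrable.norm.const_mul _).add (φ.integrable_pow_mul _ 1)).const_mul C
  refine ⟨hint.mono' (hcont q).aestronglyMeasurable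
    (.of_forall fun x => hbound x q (Metric.mem_ball_self one_pos)), ?_⟩
  exact hasFDerivAt_integral_of_dominated_of_fderiv_le (Metric.ball_mem_nhds q one_pos)
    (.of_forall fun q' => (integrable_mul_ridge α χ φ q').aestronglyMeasurable)
    (integrable_mul_ridge α χ φ q) (hcont q).aestronglyMeasurable
    (.of_forall hbound) hint
    (.of_forall fun x q' _ =>
      ((contDiff_ridge_right α χ x).differentiable (by simp) q').hasFDerivAt.const_mul (φ x))

theorem fderiv_analysis {d : ℕ} (α : Fin (d + 1) → ℝ) (χ : 𝓢(ℝ, ℂ)) (φ : 𝓢(Rn d, ℂ))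
    (q w : Rn d × ℝ × Rn d) :
    fderiv ℝ (analysis α χ φ) q w =
      (∑ k, (w.1 k : ℂ) * analysis α (SchwartzMap.derivCLM ℂ ℂ χ) (mulX k φ) q) -
        w.2.1 * analysis α (SchwartzMap.derivCLM ℂ ℂ χ) φ q +
      ∑ k, Complex.I * w.2.2 k * (Real.cot (α k) * q.2.2 k * analysis α χ φ q -
        (Real.sin (α k) : ℂ)⁻¹ * analysis α χ (mulX k φ) q) := by
  obtain ⟨hi, h⟩ := hasFDerivAt_analysis α χ φ q
  rw [h.fderiv, ContinuousLinearMap.integral_apply hi]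
  have hI := hasIntegral_analysis α (q := q)
  set χ' := SchwartzMap.derivCLM ℂ ℂ χ
  have key := ((HasIntegral.sum Finset.univ fun k _ => (hI χ' (mulX k φ)).const_mul (w.1 k)).sub
    ((hI χ' φ).const_mul w.2.1)).add (HasIntegral.sum Finset.univ fun k _ =>
      (((hI χ φ).const_mul (Real.cot (α k) * q.2.2 k)).sub
        ((hI χ (mulX k φ)).const_mul (Real.sin (α k))⁻¹)).const_mul (Complex.I * w.2.2 k))
  rw [← key.eq]
  congr 1
  ext x
  simp only [smul_apply, fderiv_ridge_right, ridgeDeriv, smul_eq_mul,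
    mulX_apply, phaseGrad_zero, inner_zero_right, add_zero, zero_add]
  simp only [phaseGrad]
  push_cast
  rw [ofReal_inner_eq_sum]
  simp only [Finset.mul_sum, Finset.sum_mul, mul_add, mul_sub, sub_mul]
  congr 1
  · congr 1
    · exact Finset.sum_congr rfl fun k _ => by ring
    · ring
  · exact Finset.sum_congr rfl fun k _ => by ring

/-- The derivative formula reproduces analysis transforms with coefficients affine in a, so the
induction must run over all windows and all φ simultaneously. -/
theorem contDiff_analysis {d : ℕ} (α : Fin (d + 1) → ℝ) (χ : 𝓢(ℝ, ℂ)) (φ : 𝓢(Rn d, ℂ)) :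
    ContDiff ℝ ∞ (analysis α χ φ) := by
  rw [contDiff_infty]
  intro n
  induction n generalizing χ φ with
  | zero =>
    refine contDiff_zero.2 (continuous_iff_continuousAt.2 fun q => ?_)
    exact (hasFDerivAt_analysis α χ φ q).2.continuousAt
  | succ n ih =>
    refine contDiff_succ_iff_fderiv_apply.2 ⟨
      fun q => (hasFDerivAt_analysis α χ φ q).2.differentiableAt,
      fun h => absurd h (WithTop.natCast_ne_top n), fun w => ?_⟩
    simp only [fderiv_analysis]
    have hp (k : Fin (d + 1)) : ContDiff ℝ n (fun q : Rn d × ℝ × Rn d => (q.2.2 k : ℂ)) :=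
      (Complex.ofRealCLM ∘L EuclideanSpace.proj (𝕜 := ℝ) k ∘L ContinuousLinearMap.snd ℝ ℝ (Rn d)
        ∘L ContinuousLinearMap.snd ℝ (Rn d) (ℝ × Rn d)).contDiff
    exact ((ContDiff.sum fun k _ => contDiff_const.mul (ih _ _)).sub
      (contDiff_const.mul (ih _ _))).add (ContDiff.sum fun k _ => contDiff_const.mul
        (((contDiff_const.mul (hp k)).mul (ih _ _)).sub (contDiff_const.mul (ih _ _))))

theorem coord_b_mul_analysis {d : ℕ} (α : Fin (d + 1) → ℝ) (χ : 𝓢(ℝ, ℂ)) (φ : 𝓢(Rn d, ℂ))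
    (q : Rn d × ℝ × Rn d) :
    q.2.1 * analysis α χ φ q =
      (∑ k, (q.1 k : ℂ) * analysis α χ (mulX k φ) q) - analysis α (mulCoord χ) φ q := by
  have hI := hasIntegral_analysis α (q := q)
  rw [← ((HasIntegral.sum Finset.univ fun k _ => (hI χ (mulX k φ)).const_mul (q.1 k)).sub
    (hI (mulCoord χ) φ)).eq, ← ((hI χ φ).const_mul q.2.1).eq]
  congr 1
  ext x
  rw [mul_left_comm, coord_mul_ridge, mul_sub, Finset.sum_mul, Finset.mul_sum]
  congr 1
  exact Finset.sum_congr rfl fun k _ => by rw [mulX_apply]; ring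

/-- Integrate ∂_{x_k} of φ · ridge. The derivative of the phase contributes i (x_k cot α_k - a_k /
sin α_k), and the vanishing of the integral is solved for a_k. -/
theorem coord_a_mul_analysis {d : ℕ} (α : Fin (d + 1) → ℝ) (χ : 𝓢(ℝ, ℂ)) (φ : 𝓢(Rn d, ℂ))
    (q : Rn d × ℝ × Rn d) (k : Fin (d + 1)) (hk : Real.sin (α k) ≠ 0) :
    q.2.2 k * analysis α χ φ q =
      Real.sin (α k) * (Real.cot (α k) * analysis α χ (mulX k φ) q -
        Complex.I * (analysis α χ (partialX k φ) q +
          q.1 k * analysis α (SchwartzMap.derivCLM ℂ ℂ χ) φ q)) := by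
  have hI := hasIntegral_analysis α (q := q)
  set χ' := SchwartzMap.derivCLM ℂ ℂ χ with hχ'
  have key := ((hI χ (partialX k φ)).add ((hI χ' φ).const_mul (q.1 k))).add
    (((hI χ (mulX k φ)).const_mul (Complex.I * Real.cot (α k))).sub
      ((hI χ φ).const_mul (Complex.I * (Real.sin (α k) : ℂ)⁻¹ * q.2.2 k)))
  have e : (fun x => fderiv ℝ (fun x => φ x * ridge α χ x q) x (EuclideanSpace.single k 1)) =
      fun x => partialX k φ x * ridge α χ x q + q.1 k * (φ x * ridge α χ' x q) +
        (Complex.I * Real.cot (α k) * (mulX k φ x * ridge α χ x q) -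
          Complex.I * (Real.sin (α k) : ℂ)⁻¹ * q.2.2 k * (φ x * ridge α χ x q)) := by
    ext x
    rw [fderiv_fun_mul φ.differentiableAt
      ((contDiff_ridge_left α χ q).differentiable (by simp) x)]
    simp only [add_apply, smul_apply, smul_eq_mul, fderiv_ridge_left, ridgeDeriv,
      phaseGrad_single, partialX_apply, mulX_apply]
    simp [phaseGrad_zero, EuclideanSpace.inner_single_right, ← hχ']
    ring
  rw [← e] at key
  have h0 := key.eq.symm.trans (integral_fderiv_eq_zero _
    (φ.differentiable.mul ((contDiff_ridge_left α χ q).differentiable (by simp)))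
    (hI χ φ).integrable key.integrable)
  have hs : (Real.sin (α k) : ℂ) * (Real.sin (α k) : ℂ)⁻¹ = 1 :=
    mul_inv_cancel₀ (by exact_mod_cast hk)
  -- Multiplying the vanishing integral by i sin α_k isolates the factor a_k; the other terms only
  -- apply sin · sin⁻¹ = 1 and i² = -1.
  linear_combination (Complex.I * Real.sin (α k)) * h0 -
    q.2.2 k * analysis α χ φ q * hs + (q.2.2 k * analysis α χ φ q * Real.sin (α k) *
      (Real.sin (α k) : ℂ)⁻¹ - Real.sin (α k) * Real.cot (α k) * analysis α χ (mulX k φ) q) *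
      Complex.I_sq

/-! ### Directional derivatives on `𝕐²ⁿ` -/

/-- The derivative at a point of `𝕐²ⁿ` of the homogeneous extension, in the direction `v`. -/
def dirDeriv {d : ℕ} (v : Rn d × ℝ × Rn d) (Φ : Y d → ℂ) : Y d → ℂ :=
  fun p => fderiv ℝ (lift Φ) ((p.1 : Rn d), p.2) v

theorem coe_sphere_ne_zero {d : ℕ} (u : Sph d) : (u : Rn d) ≠ 0 := ne_zero_of_mem_unit_sphere u

theorem IsSmooth.differentiableAt_lift {d : ℕ} {Φ : Y d → ℂ} (h : IsSmooth Φ)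
    {q : Rn d × ℝ × Rn d} (hq : q.1 ≠ 0) : DifferentiableAt ℝ (DSTFRFT.lift Φ) q :=
  (h.lift hq).differentiableAt (by simp)

theorem IsSmooth.dirDeriv {d : ℕ} {Φ : Y d → ℂ} (h : IsSmooth Φ) (v : Rn d × ℝ × Rn d) :
    IsSmooth (dirDeriv v Φ) :=
  isSmooth_of_contDiffAt (G := fun q => fderiv ℝ (DSTFRFT.lift Φ) q v) fun q hq =>
    ((h.lift hq).fderiv_right (m := ∞) (by simp)).clm_apply contDiffAt_const

theorem IsSmooth.mul {d : ℕ} {Φ Ψ : Y d → ℂ} (h : IsSmooth Φ) (h' : IsSmooth Ψ) :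
    IsSmooth (fun p => Φ p * Ψ p) := by
  have := isSmooth_of_contDiffAt (G := fun q => DSTFRFT.lift Φ q * DSTFRFT.lift Ψ q)
    fun q hq => (h.lift hq).mul (h'.lift hq)
  simpa [DSTFRFT.lift, radial_coe] using this

theorem dirDeriv_add {d : ℕ} {Φ Ψ : Y d → ℂ} (h : IsSmooth Φ) (h' : IsSmooth Ψ)
    (v : Rn d × ℝ × Rn d) : dirDeriv v (Φ + Ψ) = dirDeriv v Φ + dirDeriv v Ψ := by
  ext p
  have := fderiv_add (h.differentiableAt_lift (q := ((p.1 : Rn d), p.2)) (coe_sphere_ne_zero p.1))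
    (h'.differentiableAt_lift (coe_sphere_ne_zero p.1))
  exact congrArg (fun L : Rn d × ℝ × Rn d →L[ℝ] ℂ => L v) this

theorem dirDeriv_mul {d : ℕ} {Φ Ψ : Y d → ℂ} (h : IsSmooth Φ) (h' : IsSmooth Ψ)
    (v : Rn d × ℝ × Rn d) :
    dirDeriv v (fun p => Φ p * Ψ p) = fun p => dirDeriv v Φ p * Ψ p + Φ p * dirDeriv v Ψ p := by
  ext p
  have := fderiv_mul (h.differentiableAt_lift (q := ((p.1 : Rn d), p.2)) (coe_sphere_ne_zero p.1))
    (h'.differentiableAt_lift (coe_sphere_ne_zero p.1))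
  have := congrArg (fun L : Rn d × ℝ × Rn d →L[ℝ] ℂ => L v) this
  simp only [add_apply, smul_apply, smul_eq_mul] at this
  refine this.trans ?_
  simp only [dirDeriv, DSTFRFT.lift, radial_coe]
  ring

theorem dirDeriv_const {d : ℕ} (c : ℂ) (v : Rn d × ℝ × Rn d) :
    dirDeriv v (fun _ : Y d => c) = fun _ => 0 := by
  ext p
  have : lift (fun _ : Y d => c) = fun _ => c := rfl
  simp [dirDeriv, this]

theorem dirDeriv_smul_left {d : ℕ} (c : ℝ) (v : Rn d × ℝ × Rn d) (Φ : Y d → ℂ) (p : Y d) :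
    dirDeriv (c • v) Φ p = c * dirDeriv v Φ p := by
  simp [dirDeriv]

theorem partialB_eq_dirDeriv {d : ℕ} {Φ : Y d → ℂ} (h : IsSmooth Φ) :
    partialB Φ = dirDeriv (0, 1, 0) Φ := by
  ext p
  have h1 : HasFDerivAt (fun t : ℝ => ((p.1 : Rn d), t, p.2.2))
      ((0 : ℝ →L[ℝ] Rn d).prod ((ContinuousLinearMap.id ℝ ℝ).prod 0)) p.2.1 :=
    (hasFDerivAt_const _ _).prodMk ((hasFDerivAt_id _).prodMk (hasFDerivAt_const _ _))
  have h2 := (h.differentiableAt_lift (q := ((p.1 : Rn d), p.2))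
    (coe_sphere_ne_zero p.1)).hasFDerivAt.comp p.2.1 (f := fun t : ℝ => ((p.1 : Rn d), t, p.2.2)) h1
  simp only [Function.comp_def, DSTFRFT.lift, radial_coe] at h2
  simp only [partialB, h2.fderiv]
  simp [dirDeriv]

theorem partialA_eq_dirDeriv {d : ℕ} (j : Fin (d + 1)) {Φ : Y d → ℂ} (h : IsSmooth Φ) :
    partialA j Φ = dirDeriv (0, 0, EuclideanSpace.single j 1) Φ := by
  ext p
  have h1 : HasFDerivAt (fun a : Rn d => ((p.1 : Rn d), p.2.1, a))
      ((0 : Rn d →L[ℝ] Rn d).prod ((0 : Rn d →L[ℝ] ℝ).prod (ContinuousLinearMap.id ℝ (Rn d))))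
      p.2.2 :=
    (hasFDerivAt_const _ _).prodMk ((hasFDerivAt_const _ _).prodMk (hasFDerivAt_id _))
  have h2 := (h.differentiableAt_lift (q := ((p.1 : Rn d), p.2))
    (coe_sphere_ne_zero p.1)).hasFDerivAt.comp p.2.2
      (f := fun a : Rn d => ((p.1 : Rn d), p.2.1, a)) h1
  simp only [Function.comp_def, DSTFRFT.lift, radial_coe] at h2
  simp only [partialA, h2.fderiv]
  simp [dirDeriv]

theorem fderiv_slice_radial {d : ℕ} {Φ : Y d → ℂ} (h : IsSmooth Φ) (u : Sph d) (s : ℝ × Rn d)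
    (e : Rn d) :
    fderiv ℝ (fun x => Φ (radial x, s)) (u : Rn d) e = dirDeriv (e, 0) Φ (u, s) := by
  have h1 : HasFDerivAt (fun x : Rn d => (x, s))
      ((ContinuousLinearMap.id ℝ (Rn d)).prod 0) (u : Rn d) :=
    (hasFDerivAt_id _).prodMk (hasFDerivAt_const _ _)
  have h2 := (h.differentiableAt_lift (q := ((u : Rn d), s))
    (coe_sphere_ne_zero u)).hasFDerivAt.comp (u : Rn d) (f := fun x : Rn d => (x, s)) h1
  simp only [Function.comp_def, DSTFRFT.lift] at h2
  simp only [h2.fderiv]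
  simp [dirDeriv]

/-! ### Homogeneity of degree zero and the Laplace–Beltrami operator. -/

theorem coe_radial {d : ℕ} {x : Rn d} (hx : x ≠ 0) : (radial x : Rn d) = ‖x‖⁻¹ • x := by
  simp [radial, hx]

theorem radial_smul {d : ℕ} {c : ℝ} (hc : 0 < c) (x : Rn d) : radial (c • x) = radial x := by
  by_cases hx : x = 0
  · simp [hx]
  · ext1
    rw [coe_radial hx, coe_radial (smul_ne_zero hc.ne' hx), norm_smul, smul_smul,
      Real.norm_of_nonneg hc.le]
    congr 1
    field_simp

/-- The extension is invariant under scaling by ‖y‖⁻¹, so its gradient is homogeneous of degree -1.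
-/
theorem fderiv_comp_radial {d : ℕ} {Φ : Y d → ℂ} (h : IsSmooth Φ) (s : ℝ × Rn d) (e : Rn d)
    {y : Rn d} (hy : y ≠ 0) :
    fderiv ℝ (fun x => Φ (radial x, s)) y e = (‖y‖⁻¹ : ℝ) * dirDeriv (e, 0) Φ (radial y, s) := by
  have hc : 0 < ‖y‖⁻¹ := by positivity
  have h1 : (fun x => Φ (radial x, s)) = fun x => (fun x => Φ (radial x, s)) (‖y‖⁻¹ • x) := by
    ext x
    simp only [radial_smul hc]
  rw [h1, fderiv_comp_smul (f := fun x => Φ (radial x, s)), ← coe_radial hy, smul_apply, fderiv_slice_radial h, Complex.real_smul]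

/-- Euler's relation: the extension is constant along rays. -/
theorem dirDeriv_self {d : ℕ} {Φ : Y d → ℂ} (h : IsSmooth Φ) (p : Y d) :
    dirDeriv ((p.1 : Rn d), 0) Φ p = 0 := by
  rw [← fderiv_slice_radial h p.1 p.2,
    ← ((h.slice_radial p).differentiableAt (by simp)).lineDeriv_eq_fderiv]
  refine HasLineDerivAt.lineDeriv ((hasDerivAt_const (0 : ℝ) (Φ p)).congr_of_eventuallyEq ?_)
  filter_upwards [isOpen_lt continuous_const continuous_id |>.mem_nhds
    (show (-1 : ℝ) < (0 : ℝ) by norm_num)] with t ht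
  have hs : (p.1 : Rn d) + t • (p.1 : Rn d) = (1 + t) • (p.1 : Rn d) := by
    rw [add_smul, one_smul]
  have ht' : 0 < 1 + t := by
    have : (-1 : ℝ) < t := ht
    linarith
  rw [hs, radial_smul ht', radial_coe]

theorem hasDerivAt_inv_norm {d : ℕ} (u : Sph d) (v : Rn d) :
    HasDerivAt (fun t : ℝ => ‖(u : Rn d) + t • v‖⁻¹) (-inner ℝ (u : Rn d) v) 0 := by
  have hu : ‖(u : Rn d)‖ = 1 := norm_eq_of_mem_sphere u
  have h1 : HasDerivAt (fun t : ℝ => (u : Rn d) + t • v) v 0 := by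
    simpa using ((hasDerivAt_id (0 : ℝ)).smul_const v).const_add (u : Rn d)
  have h2 := (h1.norm_sq.sqrt (by simp [hu])).inv (by simp [hu])
  simp only [Real.sqrt_sq (norm_nonneg _)] at h2
  refine h2.congr_deriv ?_
  simp [hu]

theorem eventually_add_smul_ne_zero {d : ℕ} (u : Sph d) (v : Rn d) :
    ∀ᶠ t : ℝ in nhds 0, (u : Rn d) + t • v ≠ 0 := by
  have hc : Continuous fun t : ℝ => (u : Rn d) + t • v := by fun_prop
  exact (isOpen_ne.preimage hc).mem_nhds (by simp [coe_sphere_ne_zero u])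

open Laplacian in
-- Iterating `dirDeriv` restricts the first derivative to the sphere and extends it again with
-- degree 0, whereas the true gradient has degree -1. The factor ‖y‖⁻¹ accounts for the discrepancy:
-- its derivative gives -u_i ∂_i Φ, and these terms sum to a radial derivative, which vanishes.
theorem sphLaplacian_eq_sum {d : ℕ} {Φ : Y d → ℂ} (h : IsSmooth Φ) :
    sphLaplacian Φ = fun p => ∑ i, dirDeriv (EuclideanSpace.single i 1, 0)
      (dirDeriv (EuclideanSpace.single i 1, 0) Φ) p := by
  ext p
  have key : ∀ i, fderiv ℝ (fun y : Rn d => fderiv ℝ (fun x => Φ (radial x, p.2)) y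
        (EuclideanSpace.single i 1)) (p.1 : Rn d) (EuclideanSpace.single i 1) =
      dirDeriv (EuclideanSpace.single i 1, 0) (dirDeriv (EuclideanSpace.single i 1, 0) Φ) p -
        dirDeriv (((p.1 : Rn d) i) • (EuclideanSpace.single i 1, 0)) Φ p := by
    intro i
    set e : Rn d := EuclideanSpace.single i 1
    have hd := h.dirDeriv (e, 0)
    have h1 : (fun y : Rn d => fderiv ℝ (fun x => Φ (radial x, p.2)) y e) =ᶠ[nhds (p.1 : Rn d)]
        fun y => (‖y‖⁻¹ : ℝ) * dirDeriv (e, 0) Φ (radial y, p.2) := by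
      filter_upwards [isOpen_ne.mem_nhds (coe_sphere_ne_zero p.1)] with y hy
      exact fderiv_comp_radial h p.2 e hy
    have hdiff : DifferentiableAt ℝ
        (fun y : Rn d => dirDeriv (e, 0) Φ (radial y, p.2)) (p.1 : Rn d) :=
      (hd.slice_radial p).differentiableAt (by simp)
    have hn : DifferentiableAt ℝ (fun y : Rn d => ((‖y‖⁻¹ : ℝ) : ℂ)) (p.1 : Rn d) :=
      Complex.ofRealCLM.differentiableAt.comp _
        (((contDiffAt_norm ℝ (coe_sphere_ne_zero p.1)).inv (n := 1)
          (norm_ne_zero_iff.2 (coe_sphere_ne_zero p.1))).differentiableAt (by simp))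
    have hn' : fderiv ℝ (fun y : Rn d => ((‖y‖⁻¹ : ℝ) : ℂ)) (p.1 : Rn d) e =
        -((p.1 : Rn d) i : ℂ) := by
      rw [← hn.lineDeriv_eq_fderiv]
      refine HasLineDerivAt.lineDeriv ((hasDerivAt_inv_norm p.1 e).ofReal_comp.congr_deriv ?_)
      simp [e, EuclideanSpace.inner_single_right]
    rw [h1.fderiv_eq, fderiv_fun_mul hn hdiff]
    simp only [add_apply, smul_apply, smul_eq_mul, hn', fderiv_slice_radial hd, radial_coe,
      norm_eq_of_mem_sphere p.1]
    rw [dirDeriv_smul_left]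
    simp
    ring
  simp only [sphLaplacian]
  rw [InnerProductSpace.laplacian_eq_iteratedFDeriv_orthonormalBasis _
    (EuclideanSpace.basisFun (Fin (d + 1)) ℝ)]
  -- The corrections add up to the derivative in the direction u itself.
  have h0 : ∑ i, dirDeriv (((p.1 : Rn d) i) • (EuclideanSpace.single i (1 : ℝ), (0 : ℝ × Rn d)))
      Φ p = 0 := by
    rw [← dirDeriv_self h p]
    simp only [dirDeriv, ← map_sum]
    congr 1
    refine Prod.ext ?_ (by simp [Prod.snd_sum])
    rw [Prod.fst_sum]
    ext j
    simp [Pi.single_apply]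
  rw [← sub_zero (∑ i, _), ← h0, ← Finset.sum_sub_distrib]
  refine Finset.sum_congr rfl fun i _ => ?_
  rw [← key i, iteratedFDeriv_two_apply]
  have hf : DifferentiableAt ℝ (fderiv ℝ (fun x : Rn d => Φ (radial x, p.2))) (p.1 : Rn d) :=
    ((h.slice_radial p).fderiv_right (m := 1) (by norm_cast)).differentiableAt (by simp)
  rw [fderiv_clm_apply hf (differentiableAt_const _)]
  simp

/-! ### Restrictions of Euclidean functions to the sphere. -/

theorem isSmooth_restrict {d : ℕ} {G : Rn d × ℝ × Rn d → ℂ} (h : ContDiff ℝ ∞ G) :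
    IsSmooth (fun p : Y d => G ((p.1 : Rn d), p.2)) :=
  isSmooth_of_contDiffAt fun _ _ => h.contDiffAt

/-- The lift precomposes with the radial projection, whose differential at u is the orthogonal
projection onto the tangent space. -/
theorem dirDeriv_restrict {d : ℕ} {G : Rn d × ℝ × Rn d → ℂ} (h : ContDiff ℝ ∞ G)
    (v : Rn d × ℝ × Rn d) (p : Y d) :
    dirDeriv v (fun p : Y d => G ((p.1 : Rn d), p.2)) p =
      fderiv ℝ G ((p.1 : Rn d), p.2)
        (v.1 - (inner ℝ (p.1 : Rn d) v.1 : ℝ) • (p.1 : Rn d), v.2) := by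
  have hs := isSmooth_restrict h
  rw [dirDeriv, ← (hs.differentiableAt_lift (coe_sphere_ne_zero p.1)).lineDeriv_eq_fderiv]
  refine HasLineDerivAt.lineDeriv ?_
  have h1 : HasDerivAt (fun t : ℝ => (p.1 : Rn d) + t • v.1) v.1 0 := by
    simpa using ((hasDerivAt_id (0 : ℝ)).smul_const v.1).const_add (p.1 : Rn d)
  have h2 : HasDerivAt (fun t : ℝ => p.2 + t • v.2) v.2 0 := by
    simpa using ((hasDerivAt_id (0 : ℝ)).smul_const v.2).const_add p.2
  have h3 := ((hasDerivAt_inv_norm p.1 v.1).smul h1).prodMk h2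
  have h4 := (h.differentiable (by simp) ((p.1 : Rn d), p.2)).hasFDerivAt.comp_hasDerivAt_of_eq
    (0 : ℝ) h3 (by simp [norm_eq_of_mem_sphere p.1])
  refine (h4.congr_of_eventuallyEq ?_).congr_deriv ?_
  · filter_upwards [eventually_add_smul_ne_zero p.1 v.1] with t ht
    simp only [DSTFRFT.lift, Function.comp_apply, Prod.fst_add, Prod.smul_fst, Prod.snd_add,
      Prod.smul_snd, coe_radial ht]
    rfl
  · congr 2
    simp [norm_eq_of_mem_sphere p.1, sub_eq_add_neg]

/-! ### Families dominated by a continuous seminorm -/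

/-- A family of real functions that is dominated, uniformly in the point, by a continuous
seminorm of the parameter. -/
def IsDominated {E P : Type*} [AddCommGroup E] [Module ℂ E] [TopologicalSpace E]
    (W : E → P → ℝ) : Prop :=
  ∃ q : Seminorm ℂ E, Continuous q ∧ ∀ φ p, W φ p ≤ q φ

namespace IsDominated

variable {E P : Type*} [AddCommGroup E] [Module ℂ E] [TopologicalSpace E] {V W : E → P → ℝ}

theorem mono (hW : IsDominated W) (h : ∀ φ p, V φ p ≤ W φ p) : IsDominated V := by
  obtain ⟨q, hq, hb⟩ := hW
  exact ⟨q, hq, fun φ p => (h φ p).trans (hb φ p)⟩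

theorem add (hV : IsDominated V) (hW : IsDominated W) :
    IsDominated (fun φ p => V φ p + W φ p) := by
  obtain ⟨q, hq, hb⟩ := hV
  obtain ⟨q', hq', hb'⟩ := hW
  exact ⟨q + q', hq.add hq', fun φ p => add_le_add (hb φ p) (hb' φ p)⟩

theorem const_mul {c : ℝ} (hc : 0 ≤ c) (hW : IsDominated W) :
    IsDominated (fun φ p => c * W φ p) := by
  obtain ⟨q, hq, hb⟩ := hW
  lift c to NNReal using hc
  exact ⟨c • q, continuous_const.mul hq,
    fun φ p => mul_le_mul_of_nonneg_left (hb φ p) c.2⟩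

theorem zero : IsDominated (fun (_ : E) (_ : P) => (0 : ℝ)) :=
  ⟨0, continuous_const, fun _ _ => le_rfl⟩

theorem sum {ι : Type*} (s : Finset ι) {W : ι → E → P → ℝ} (h : ∀ i ∈ s, IsDominated (W i)) :
    IsDominated (fun φ p => ∑ i ∈ s, W i φ p) := by
  classical
  induction s using Finset.induction_on with
  | empty => simpa using zero
  | insert i s hi ih =>
    simp only [Finset.sum_insert hi]
    exact (h i (Finset.mem_insert_self i s)).add
      (ih fun j hj => h j (Finset.mem_insert_of_mem hj))

end IsDominated

/-! ### The families generated by the analysis transform -/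

/-- The families of functions on `𝕐²ⁿ` generated by the analysis transforms of `L φ` under
addition, scalar multiplication and multiplication by the coordinates of the sphere. -/
inductive AnalysisFamily {d : ℕ} (α : Fin (d + 1) → ℝ) : (𝓢(Rn d, ℂ) → Y d → ℂ) → Prop
  | base (L : 𝓢(Rn d, ℂ) →L[ℂ] 𝓢(Rn d, ℂ)) (χ : 𝓢(ℝ, ℂ)) :
      AnalysisFamily α fun φ p => analysis α χ (L φ) ((p.1 : Rn d), p.2)
  | add {V W : 𝓢(Rn d, ℂ) → Y d → ℂ} : AnalysisFamily α V → AnalysisFamily α W →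
      AnalysisFamily α fun φ p => V φ p + W φ p
  | const_mul (c : ℂ) {W : 𝓢(Rn d, ℂ) → Y d → ℂ} : AnalysisFamily α W →
      AnalysisFamily α fun φ p => c * W φ p
  | mul_u (k : Fin (d + 1)) {W : 𝓢(Rn d, ℂ) → Y d → ℂ} : AnalysisFamily α W →
      AnalysisFamily α fun φ p => ((p.1 : Rn d) k : ℂ) * W φ p

theorem isSmooth_coord_u {d : ℕ} (k : Fin (d + 1)) :
    IsSmooth (fun p : Y d => (((p.1 : Rn d) k : ℝ) : ℂ)) :=
  isSmooth_restrict (G := fun q : Rn d × ℝ × Rn d => ((q.1 k : ℝ) : ℂ))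
    (Complex.ofRealCLM ∘L EuclideanSpace.proj (𝕜 := ℝ) k ∘L
      ContinuousLinearMap.fst ℝ (Rn d) (ℝ × Rn d)).contDiff

/-- The tangential projection keeps the result polynomial in u, which is why families closed under
multiplication by u_k can be closed under differentiation. -/
theorem dirDeriv_coord_u {d : ℕ} (k : Fin (d + 1)) (v : Rn d × ℝ × Rn d) (p : Y d) :
    dirDeriv v (fun p : Y d => (((p.1 : Rn d) k : ℝ) : ℂ)) p =
      v.1 k - (∑ j, ((p.1 : Rn d) j : ℂ) * (v.1 j : ℂ)) * ((p.1 : Rn d) k : ℂ) := by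
  set G := (Complex.ofRealCLM ∘L EuclideanSpace.proj (𝕜 := ℝ) k ∘L
      ContinuousLinearMap.fst ℝ (Rn d) (ℝ × Rn d)) with hG
  have h := dirDeriv_restrict (G := G) G.contDiff v p
  rw [G.fderiv] at h
  refine h.trans ?_
  rw [← ofReal_inner_eq_sum]
  simp [hG]

theorem isSmooth_coord_a {d : ℕ} (k : Fin (d + 1)) :
    IsSmooth (fun p : Y d => ((p.2.2 k : ℝ) : ℂ)) :=
  isSmooth_restrict (G := fun q : Rn d × ℝ × Rn d => ((q.2.2 k : ℝ) : ℂ))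
    (Complex.ofRealCLM ∘L EuclideanSpace.proj (𝕜 := ℝ) k ∘L ContinuousLinearMap.snd ℝ ℝ (Rn d)
        ∘L ContinuousLinearMap.snd ℝ (Rn d) (ℝ × Rn d)).contDiff

theorem dirDeriv_coord_a {d : ℕ} (k : Fin (d + 1)) (v : Rn d × ℝ × Rn d) (p : Y d) :
    dirDeriv v (fun p : Y d => ((p.2.2 k : ℝ) : ℂ)) p = v.2.2 k := by
  set G := (Complex.ofRealCLM ∘L EuclideanSpace.proj (𝕜 := ℝ) k ∘L
    ContinuousLinearMap.snd ℝ ℝ (Rn d) ∘L ContinuousLinearMap.snd ℝ (Rn d) (ℝ × Rn d)) with hG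
  have h := dirDeriv_restrict (G := G) G.contDiff v p
  rw [G.fderiv] at h
  refine h.trans ?_
  simp [hG]

namespace AnalysisFamily

variable {d : ℕ} {α : Fin (d + 1) → ℝ} {V W : 𝓢(Rn d, ℂ) → Y d → ℂ}

theorem sub (hV : AnalysisFamily α V) (hW : AnalysisFamily α W) :
    AnalysisFamily α fun φ p => V φ p - W φ p := by
  simpa only [neg_one_mul, ← sub_eq_add_neg] using hV.add (hW.const_mul (-1))

theorem sum {ι : Type*} (s : Finset ι) {W : ι → 𝓢(Rn d, ℂ) → Y d → ℂ}
    (h : ∀ i ∈ s, AnalysisFamily α (W i)) : AnalysisFamily α fun φ p => ∑ i ∈ s, W i φ p := by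
  classical
  induction s using Finset.induction_on with
  -- The zero family is 0 times a generator.
  | empty => simpa using (base (α := α) 0 0).const_mul 0
  | insert i s hi ih =>
    simp only [Finset.sum_insert hi]
    exact (h i (Finset.mem_insert_self i s)).add
      (ih fun j hj => h j (Finset.mem_insert_of_mem hj))

theorem isSmooth (hW : AnalysisFamily α W) (φ : 𝓢(Rn d, ℂ)) : IsSmooth (W φ) := by
  induction hW with
  | base L χ => exact isSmooth_restrict (contDiff_analysis α χ (L φ))
  | add _ _ h h' => exact h.add h'
  | const_mul c _ h => exact h.smul c
  | mul_u k _ h => exact (isSmooth_coord_u k).mul h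

/-- For a generator the bound is a multiple of the L¹ norm of L φ, a continuous seminorm of φ. Since
|u_k| ≤ 1, multiplication by u_k is harmless; the unbounded factors a_k and b are not generators and
are proved to preserve the class instead. -/
theorem isDominated (hW : AnalysisFamily α W) : IsDominated fun φ p => ‖W φ p‖ := by
  induction hW with
  | base L χ =>
    have h0 : IsDominated fun (φ : 𝓢(Rn d, ℂ)) (_ : Y d) => ∫ x, ‖L φ x‖ := by
      refine ⟨(normSeminorm ℂ _).comp
        ((SchwartzMap.toLpCLM ℂ ℂ 1 MeasureTheory.volume).comp L).toLinearMap,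
        continuous_norm.comp ((SchwartzMap.toLpCLM ℂ ℂ 1 MeasureTheory.volume).comp L).continuous,
        fun φ p => ?_⟩
      exact (SchwartzMap.norm_toLp_one (f := L φ) (μ := MeasureTheory.volume)).symm.le
    exact (h0.const_mul (c := SchwartzMap.seminorm ℝ 0 0 χ * ‖kernelConst α‖)
      (by positivity)).mono fun φ p => norm_analysis_le α χ (L φ) _
  | add _ _ h h' => exact (h.add h').mono fun φ p => norm_add_le _ _
  | const_mul c _ h => exact (h.const_mul (norm_nonneg c)).mono fun φ p => (norm_mul _ _).le
  | @mul_u k W _ h =>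
    refine h.mono fun φ p => ?_
    rw [norm_mul, Complex.norm_real]
    refine mul_le_of_le_one_left (norm_nonneg _) ?_
    exact (PiLp.norm_apply_le (p.1 : Rn d) k).trans (norm_eq_of_mem_sphere p.1).le

theorem mul_b (hW : AnalysisFamily α W) :
    AnalysisFamily α fun φ p => (p.2.1 : ℂ) * W φ p := by
  induction hW with
  | base L χ =>
    have h := (sum Finset.univ fun k _ => (base (α := α) (mulX k ∘L L) χ).mul_u k).sub
      (base L (mulCoord χ))
    convert h using 3 with φ p
    exact coord_b_mul_analysis α χ (L φ) ((p.1 : Rn d), p.2)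
  | add _ _ h h' => simpa only [mul_add] using h.add h'
  | const_mul c _ h => simpa only [mul_left_comm] using h.const_mul c
  | mul_u k _ h => simpa only [mul_left_comm] using h.mul_u k

theorem mul_a (hα : ∀ k, Real.sin (α k) ≠ 0) (k : Fin (d + 1)) (hW : AnalysisFamily α W) :
    AnalysisFamily α fun φ p => (p.2.2 k : ℂ) * W φ p := by
  induction hW with
  | base L χ =>
    have h := (((base (α := α) (mulX k ∘L L) χ).const_mul (Real.cot (α k))).sub
      (((base (α := α) (partialX k ∘L L) χ).add
        ((base (α := α) L (SchwartzMap.derivCLM ℂ ℂ χ)).mul_u k)).const_mul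
          Complex.I)).const_mul (Real.sin (α k))
    convert h using 3 with φ p
    exact coord_a_mul_analysis α χ (L φ) ((p.1 : Rn d), p.2) k (hα k)
  | add _ _ h h' => simpa only [mul_add] using h.add h'
  | const_mul c _ h => simpa only [mul_left_comm] using h.const_mul c
  | mul_u k _ h => simpa only [mul_left_comm] using h.mul_u k

/-- On generators the derivative formula yields window derivatives and factors x_k, u_k, a_k; the
factors x_k go into L and the factors a_k are removed by `mul_a`. The remaining cases are the
Leibniz rule. -/
theorem dirDeriv (hα : ∀ k, Real.sin (α k) ≠ 0) (v : Rn d × ℝ × Rn d)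
    (hW : AnalysisFamily α W) : AnalysisFamily α fun φ => dirDeriv v (W φ) := by
  induction hW with
  | base L χ =>
    set χ' := SchwartzMap.derivCLM ℂ ℂ χ
    have h1 := sum Finset.univ fun k _ => (base (α := α) (mulX k ∘L L) χ').const_mul (v.1 k)
    -- The radial component ⟨u, v⟩ u of the direction, subtracted by the tangential projection.
    have h2 := sum Finset.univ fun j _ => (sum Finset.univ fun k _ =>
      (base (α := α) (mulX k ∘L L) χ').mul_u k).mul_u j |>.const_mul (v.1 j)
    have h3 := (base (α := α) L χ').const_mul (v.2.1)
    have h4 := sum Finset.univ fun k _ => ((((base (α := α) L χ).mul_a hα k).const_mul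
      (Real.cot (α k))).sub ((base (α := α) (mulX k ∘L L) χ).const_mul
        (Real.sin (α k) : ℂ)⁻¹)).const_mul (Complex.I * v.2.2 k)
    convert ((h1.sub h2).sub h3).add h4 using 3 with φ p
    rw [dirDeriv_restrict (contDiff_analysis α χ (L φ)), fderiv_analysis]
    congr 1
    · congr 1
      simp only [PiLp.sub_apply, PiLp.smul_apply, smul_eq_mul, Complex.ofReal_sub,
        Complex.ofReal_mul, ofReal_inner_eq_sum, sub_mul, Finset.sum_sub_distrib, mul_assoc,
        ← Finset.mul_sum]
      congr 1
      rw [Finset.sum_mul]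
      exact Finset.sum_congr rfl fun j _ => by
        simp only [ContinuousLinearMap.comp_apply, χ']
        ring
    · simp only [mul_assoc]
      rfl
  | @add V W hV hW h h' =>
    have : ∀ φ, DSTFRFT.dirDeriv v (fun p => V φ p + W φ p) =
        DSTFRFT.dirDeriv v (V φ) + DSTFRFT.dirDeriv v (W φ) :=
      fun φ => dirDeriv_add (hV.isSmooth φ) (hW.isSmooth φ) v
    simp only [this]
    exact h.add h'
  | @const_mul c W hW h =>
    have : ∀ φ, DSTFRFT.dirDeriv v (fun p => c * W φ p) =
        fun p => c * DSTFRFT.dirDeriv v (W φ) p := fun φ => by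
      rw [dirDeriv_mul (contMDiff_const : IsSmooth fun _ => c) (hW.isSmooth φ) v]
      simp [dirDeriv_const]
    simp only [this]
    exact h.const_mul c
  | @mul_u k W hW h =>
    have := fun φ => dirDeriv_mul (isSmooth_coord_u k) (hW.isSmooth φ) v
    simp only [this, dirDeriv_coord_u]
    have h1 := (hW.const_mul (v.1 k)).sub
      (sum Finset.univ fun j _ => ((hW.mul_u k).mul_u j).const_mul (v.1 j))
    convert h1.add (h.mul_u k) using 4 with φ p
    rw [sub_mul, Finset.sum_mul, Finset.sum_mul]
    congr 1
    exact Finset.sum_congr rfl fun j _ => by ring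

theorem iterate {T : (Y d → ℂ) → Y d → ℂ}
    (hT : ∀ {W}, AnalysisFamily α W → AnalysisFamily α fun φ => T (W φ)) (n : ℕ)
    (hW : AnalysisFamily α W) : AnalysisFamily α fun φ => T^[n] (W φ) := by
  induction n with
  | zero => exact hW
  | succ n ih =>
    simp only [Function.iterate_succ_apply']
    exact hT ih

theorem mixedDeriv (hα : ∀ k, Real.sin (α k) ≠ 0) (m k : ℕ) (l : Fin (d + 1) → ℕ)
    (hW : AnalysisFamily α W) : AnalysisFamily α fun φ => mixedDeriv m k l (W φ) := by
  have hB : ∀ {W}, AnalysisFamily α W → AnalysisFamily α fun φ => partialB (W φ) := fun hW => by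
    simp only [fun φ => partialB_eq_dirDeriv (hW.isSmooth φ)]
    exact hW.dirDeriv hα _
  have hA : ∀ (j : Fin (d + 1)) {W}, AnalysisFamily α W →
      AnalysisFamily α fun φ => partialA j (W φ) := fun j {W} hW => by
    simp only [fun φ => partialA_eq_dirDeriv j (hW.isSmooth φ)]
    exact hW.dirDeriv hα _
  have hS : ∀ {W}, AnalysisFamily α W → AnalysisFamily α fun φ => sphLaplacian (W φ) :=
    fun hW => by
      simp only [fun φ => sphLaplacian_eq_sum (hW.isSmooth φ)]
      exact sum _ fun i _ => (hW.dirDeriv hα _).dirDeriv hα _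
  have hl : ∀ (L : List (Fin (d + 1))) {W}, AnalysisFamily α W → AnalysisFamily α fun φ =>
      L.foldr (fun j T => (partialA (d := d) j)^[l j] ∘ T) id (W φ) := by
    intro L
    induction L with
    | nil => exact fun h => h
    | cons j L ih => exact fun h => iterate (hA j) _ (ih h)
  exact hl _ (iterate hB m (iterate hS k hW))

/-- The weights are bounded by polynomials in b and a, and multiplying by these stays inside the
class, so the uniform bound for members suffices. -/
theorem isDominated_weighted (hα : ∀ k, Real.sin (α k) ≠ 0) (s r m k : ℕ)
    (l : Fin (d + 1) → ℕ) (hW : AnalysisFamily α W) :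
    IsDominated fun φ p => weighted s r m k l (W φ) p := by
  have hb : ∀ {W}, AnalysisFamily α W →
      AnalysisFamily α fun φ p => ((1 + p.2.1 ^ 2 : ℝ) : ℂ) * W φ p := fun hW => by
    convert hW.add hW.mul_b.mul_b using 3
    push_cast
    ring
  have ha : ∀ {W}, AnalysisFamily α W →
      AnalysisFamily α fun φ p => ((1 + ‖p.2.2‖ ^ 2 : ℝ) : ℂ) * W φ p := fun hW => by
    convert hW.add (sum Finset.univ fun j _ => (hW.mul_a hα j).mul_a hα j) using 3
    rw [EuclideanSpace.real_norm_sq_eq]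
    push_cast
    rw [add_mul, one_mul, Finset.sum_mul]
    congr 1
    exact Finset.sum_congr rfl fun j _ => by ring
  have hb' : ∀ (n : ℕ) {W}, AnalysisFamily α W →
      AnalysisFamily α fun φ p => ((1 + p.2.1 ^ 2 : ℝ) : ℂ) ^ n * W φ p := by
    intro n
    induction n with
    | zero => intro W hW; simpa using hW
    | succ n ih => intro W hW; simpa only [pow_succ, mul_assoc] using ih (hb hW)
  have ha' : ∀ (n : ℕ) {W}, AnalysisFamily α W →
      AnalysisFamily α fun φ p => ((1 + ‖p.2.2‖ ^ 2 : ℝ) : ℂ) ^ n * W φ p := by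
    intro n
    induction n with
    | zero => intro W hW; simpa using hW
    | succ n ih => intro W hW; simpa only [pow_succ, mul_assoc] using ih (ha hW)
  refine (hb' r (ha' s (hW.mixedDeriv hα m k l))).isDominated.mono fun φ p => ?_
  -- The half-integer exponent is enlarged to an integer one so that the weight is a polynomial.
  have hpow : ∀ (x : ℝ) (n : ℕ), 0 ≤ x → (1 + x) ^ ((n : ℝ) / 2) ≤ (1 + x) ^ n := fun x n hx => by
    rw [← Real.rpow_natCast]
    exact Real.rpow_le_rpow_of_exponent_le (by linarith) (half_le_self n.cast_nonneg)
  rw [norm_mul, norm_mul, norm_pow, norm_pow, Complex.norm_real, Complex.norm_real,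
    Real.norm_of_nonneg (by positivity), Real.norm_of_nonneg (by positivity), ← mul_assoc, weighted,
    sq_abs]
  gcongr
  · exact hpow _ r (by positivity)
  · exact hpow _ s (by positivity)

end AnalysisFamily

/-! ### Maps into `𝒮(𝕐²ⁿ)` and the continuous analysis operator -/

namespace SchwartzY

variable {d : ℕ}

theorem ext {Φ Ψ : SchwartzY d} (h : ∀ p, Φ p = Ψ p) : Φ = Ψ := Subtype.ext (funext h)

theorem weighted_le_seminorm (s r m k : ℕ) (l : Fin (d + 1) → ℕ) (Φ : SchwartzY d) (p : Y d) :
    weighted s r m k l Φ p ≤ SchwartzY.seminorm s r m k l Φ :=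
  le_ciSup (Φ.bddAbove s r m k l) p

theorem seminorm_le (s r m k : ℕ) (l : Fin (d + 1) → ℕ) (Φ : SchwartzY d) {M : ℝ}
    (h : ∀ p, weighted s r m k l Φ p ≤ M) : SchwartzY.seminorm s r m k l Φ ≤ M :=
  have : Nonempty (Y d) := ⟨(pole d, 0, 0)⟩
  ciSup_le h

theorem continuous_seminorm (s r m k : ℕ) (l : Fin (d + 1) → ℕ) :
    Continuous (SchwartzY.seminorm (d := d) s r m k l) :=
  (withSeminorms d).continuous_seminorm (s, r, m, k, l)

theorem continuous_of_isDominated {E : Type*} [AddCommGroup E] [Module ℂ E] [TopologicalSpace E]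
    [IsTopologicalAddGroup E] (f : E →ₗ[ℂ] SchwartzY d)
    (h : ∀ s r m k l, IsDominated fun φ p => weighted s r m k l (f φ) p) : Continuous f := by
  refine WithSeminorms.continuous_of_continuous_comp (withSeminorms d) f fun i => ?_
  obtain ⟨q, hq, hb⟩ := h i.1 i.2.1 i.2.2.1 i.2.2.2.1 i.2.2.2.2
  exact Seminorm.continuous_of_le hq fun φ => seminorm_le _ _ _ _ _ _ (hb φ)

end SchwartzY

theorem analysis_add {d : ℕ} (α : Fin (d + 1) → ℝ) (χ : 𝓢(ℝ, ℂ)) (φ φ' : 𝓢(Rn d, ℂ))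
    (q : Rn d × ℝ × Rn d) : analysis α χ (φ + φ') q = analysis α χ φ q + analysis α χ φ' q := by
  rw [← ((hasIntegral_analysis α χ φ q).add (hasIntegral_analysis α χ φ' q)).eq]
  simp only [analysis, add_apply, add_mul]

theorem analysis_smul {d : ℕ} (α : Fin (d + 1) → ℝ) (χ : 𝓢(ℝ, ℂ)) (c : ℂ) (φ : 𝓢(Rn d, ℂ))
    (q : Rn d × ℝ × Rn d) : analysis α χ (c • φ) q = c * analysis α χ φ q := by
  rw [← ((hasIntegral_analysis α χ φ q).const_mul c).eq]
  simp only [analysis, smul_apply, smul_eq_mul, mul_assoc]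

/-- The analysis transform as a linear map `𝒮(ℝⁿ) → 𝒮(𝕐²ⁿ)`. -/
def analysisLM {d : ℕ} {α : Fin (d + 1) → ℝ} (hα : ∀ k, Real.sin (α k) ≠ 0) (χ : 𝓢(ℝ, ℂ)) :
    𝓢(Rn d, ℂ) →ₗ[ℂ] SchwartzY d where
  toFun φ := ⟨fun p => analysis α χ φ ((p.1 : Rn d), p.2),
    (AnalysisFamily.base (.id ℂ _) χ).isSmooth φ, fun s r m k l => by
      obtain ⟨q, -, hq⟩ := (AnalysisFamily.base (.id ℂ _) χ).isDominated_weighted hα s r m k l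
      exact ⟨q φ, Set.forall_mem_range.2 (hq φ)⟩⟩
  map_add' φ φ' := SchwartzY.ext fun p => analysis_add α χ φ φ' _
  map_smul' c φ := SchwartzY.ext fun p => analysis_smul α χ c φ _

/-- The analysis transform as a continuous linear map `𝒮(ℝⁿ) → 𝒮(𝕐²ⁿ)`. -/
def analysisCLM {d : ℕ} {α : Fin (d + 1) → ℝ} (hα : ∀ k, Real.sin (α k) ≠ 0) (χ : 𝓢(ℝ, ℂ)) :
    𝓢(Rn d, ℂ) →L[ℂ] SchwartzY d where
  toLinearMap := analysisLM hα χ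
  cont := SchwartzY.continuous_of_isDominated (analysisLM hα χ)
    fun s r m k l => (AnalysisFamily.base (.id ℂ _) χ).isDominated_weighted hα s r m k l

/-- Complex conjugation on `𝒮(ℝ)`. -/
def conjWindow (ψ : 𝓢(ℝ, ℂ)) : 𝓢(ℝ, ℂ) :=
  SchwartzMap.postcompCLM (Complex.conjCLE : ℂ →L[ℝ] ℂ) ψ

theorem dstfrftIntegrand_eq {d : ℕ} (ψ : 𝓢(ℝ, ℂ)) (α : Fin (d + 1) → ℝ) (φ : Rn d → ℂ)
    (p : Y d) (x : Rn d) :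
    dstfrftIntegrand ψ α φ p x = φ x * ridge α (conjWindow ψ) x ((p.1 : Rn d), p.2) := by
  rw [dstfrftIntegrand, ridge, mul_assoc]
  rfl

/-! ### Derivatives in `a` and coefficient families -/

theorem partialA_comm {d : ℕ} (i j : Fin (d + 1)) {Φ : Y d → ℂ} (h : IsSmooth Φ) :
    partialA i (partialA j Φ) = partialA j (partialA i Φ) := by
  ext p
  set f : Rn d → ℂ := fun a => Φ (p.1, p.2.1, a) with hf
  have hc : ContDiffAt ℝ ∞ f p.2.2 := h.slice_a p
  have hd : DifferentiableAt ℝ (fderiv ℝ f) p.2.2 :=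
    (hc.fderiv_right (m := 1) (by norm_cast)).differentiableAt (by simp)
  have key : ∀ v w : Rn d,
      fderiv ℝ (fun a => fderiv ℝ f a w) p.2.2 v = fderiv ℝ (fderiv ℝ f) p.2.2 v w := by
    intro v w
    rw [fderiv_clm_apply hd (differentiableAt_const _)]
    simp
  have hs : IsSymmSndFDerivAt ℝ f p.2.2 := hc.isSymmSndFDerivAt (by simpa using ENat.LEInfty.out)
  exact (key _ _).trans ((hs.eq _ _).trans (key _ _).symm)

/-- The multi-index operator applies the coordinates in a fixed order, so the extra derivative is
commuted inward to the block of index j. -/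
theorem partialA_partialAMulti {d : ℕ} (j : Fin (d + 1)) (l : Fin (d + 1) → ℕ) {Φ : Y d → ℂ}
    (h : IsSmooth Φ) :
    partialA j (partialAMulti l Φ) = partialAMulti (Function.update l j (l j + 1)) Φ := by
  have hreg : ∀ L : List (Fin (d + 1)),
      IsRegularOp (L.foldr (fun j T => (partialA (d := d) j)^[l j] ∘ T) id) := by
    intro L
    induction L with
    | nil => exact IsRegularOp.id
    | cons j L ih => exact ((isRegularOp_partialA j).iterate _).comp ih
  have hcomm : ∀ (i : Fin (d + 1)) (n : ℕ) {Ψ : Y d → ℂ}, IsSmooth Ψ →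
      partialA j ((partialA i)^[n] Ψ) = (partialA i)^[n] (partialA j Ψ) := by
    intro i n Ψ hΨ
    induction n with
    | zero => rfl
    | succ n ih =>
      rw [Function.iterate_succ_apply', Function.iterate_succ_apply', ← ih,
        partialA_comm _ _ (((isRegularOp_partialA i).iterate n).smooth hΨ)]
  -- Without repetitions, raising l_j changes exactly one block if j occurs in the list, and none
  -- otherwise.
  have key : ∀ L : List (Fin (d + 1)), L.Nodup →
      (j ∉ L → L.foldr (fun j' T => (partialA (d := d) j')^[Function.update l j (l j + 1) j'] ∘ T)
        id Φ = L.foldr (fun j' T => (partialA (d := d) j')^[l j'] ∘ T) id Φ) ∧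
      (j ∈ L → partialA j (L.foldr (fun j' T => (partialA (d := d) j')^[l j'] ∘ T) id Φ) =
        L.foldr (fun j' T => (partialA (d := d) j')^[Function.update l j (l j + 1) j'] ∘ T)
          id Φ) := by
    intro L hL
    induction L with
    | nil => simp
    | cons i L ih =>
      obtain ⟨hi, hL'⟩ := List.nodup_cons.1 hL
      simp only [List.foldr_cons, Function.comp_apply]
      refine ⟨fun hj => ?_, fun hj => ?_⟩
      · rw [List.mem_cons, not_or] at hj
        rw [(ih hL').1 hj.2, Function.update_of_ne (Ne.symm hj.1)]
      · by_cases hij : j = i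
        · subst hij
          rw [(ih hL').1 hi, Function.update_self, Function.iterate_succ_apply']
        · rw [hcomm _ _ ((hreg L).smooth h), Function.update_of_ne (Ne.symm hij),
            (ih hL').2 ((List.mem_cons.1 hj).resolve_left hij)]
  exact (key _ (List.nodup_finRange _)).2 (List.mem_finRange j)

/-- The families of functions on `𝕐²ⁿ` generated by the derivatives `∂_a^l Φ` under addition,
scalar multiplication and multiplication by the coordinates of `u` and `a`. -/
inductive CoefficientFamily {d : ℕ} : (SchwartzY d → Y d → ℂ) → Prop
  | base (l : Fin (d + 1) → ℕ) : CoefficientFamily fun Φ => partialAMulti l Φ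
  | add {V W : SchwartzY d → Y d → ℂ} : CoefficientFamily V → CoefficientFamily W →
      CoefficientFamily fun Φ p => V Φ p + W Φ p
  | const_mul (c : ℂ) {W : SchwartzY d → Y d → ℂ} : CoefficientFamily W →
      CoefficientFamily fun Φ p => c * W Φ p
  | mul_u (k : Fin (d + 1)) {W : SchwartzY d → Y d → ℂ} : CoefficientFamily W →
      CoefficientFamily fun Φ p => ((p.1 : Rn d) k : ℂ) * W Φ p
  | mul_a (k : Fin (d + 1)) {W : SchwartzY d → Y d → ℂ} : CoefficientFamily W →
      CoefficientFamily fun Φ p => (p.2.2 k : ℂ) * W Φ p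

namespace CoefficientFamily

variable {d : ℕ} {V W : SchwartzY d → Y d → ℂ}

theorem isSmooth (hW : CoefficientFamily W) (Φ : SchwartzY d) : IsSmooth (W Φ) := by
  induction hW with
  | base l => exact (isRegularOp_mixedDeriv 0 0 l).smooth Φ.isSmooth
  | add _ _ h h' => exact h.add h'
  | const_mul c _ h => exact h.smul c
  | mul_u k _ h => exact (isSmooth_coord_u k).mul h
  | mul_a k _ h => exact (isSmooth_coord_a k).mul h

theorem partialA (j : Fin (d + 1)) (hW : CoefficientFamily W) :
    CoefficientFamily fun Φ => partialA j (W Φ) := by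
  induction hW with
  | base l =>
    simp only [fun Φ : SchwartzY d => partialA_partialAMulti j l Φ.isSmooth]
    exact base _
  | @add V W hV hW h h' =>
    have : ∀ Φ, DSTFRFT.partialA j (fun p => V Φ p + W Φ p) =
        DSTFRFT.partialA j (V Φ) + DSTFRFT.partialA j (W Φ) :=
      fun Φ => (isRegularOp_partialA j).add (hV.isSmooth Φ) (hW.isSmooth Φ)
    simp only [this]
    exact h.add h'
  | @const_mul c W hW h =>
    have : ∀ Φ, DSTFRFT.partialA j (fun p => c * W Φ p) = c • DSTFRFT.partialA j (W Φ) :=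
      fun Φ => (isRegularOp_partialA j).smul c (hW.isSmooth Φ)
    simp only [this]
    exact h.const_mul c
  | @mul_u k W hW h =>
    simp only [fun Φ => partialA_eq_dirDeriv j ((isSmooth_coord_u k).mul (hW.isSmooth Φ)),
      fun Φ => partialA_eq_dirDeriv j (hW.isSmooth Φ)] at h ⊢
    simp only [fun Φ => dirDeriv_mul (isSmooth_coord_u k) (hW.isSmooth Φ), dirDeriv_coord_u]
    simpa using h.mul_u k
  | @mul_a k W hW h =>
    simp only [fun Φ => partialA_eq_dirDeriv j ((isSmooth_coord_a k).mul (hW.isSmooth Φ)),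
      fun Φ => partialA_eq_dirDeriv j (hW.isSmooth Φ)] at h ⊢
    simp only [fun Φ => dirDeriv_mul (isSmooth_coord_a k) (hW.isSmooth Φ), dirDeriv_coord_a]
    exact (hW.const_mul _).add (h.mul_a k)

/-- A factor a_k costs one power of 1 + ‖a‖², so the exponents vary in the induction. Only seminorms
without derivatives in u and b occur: in the synthesis estimates those variables are never
integrated by parts. -/
theorem isDominated (hW : CoefficientFamily W) (M N : ℕ) :
    IsDominated fun Φ p => (1 + p.2.1 ^ 2) ^ M * (1 + ‖p.2.2‖ ^ 2) ^ N * ‖W Φ p‖ := by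
  induction hW generalizing M N with
  | base l =>
    -- The exponents are doubled because the seminorms use r/2 and s/2.
    refine ⟨_, SchwartzY.continuous_seminorm (2 * N) (2 * M) 0 0 l, fun Φ p => ?_⟩
    refine le_trans (le_of_eq ?_) (SchwartzY.weighted_le_seminorm _ _ _ _ _ _ p)
    have h : ∀ n : ℕ, ((2 * n : ℕ) : ℝ) / 2 = n := fun n => by push_cast; ring
    simp only [weighted, h, Real.rpow_natCast, sq_abs]
    rfl
  | add _ _ h h' =>
    refine ((h M N).add (h' M N)).mono fun Φ p => ?_
    rw [← mul_add]
    exact mul_le_mul_of_nonneg_left (norm_add_le _ _) (by positivity)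
  | const_mul c _ h =>
    refine ((h M N).const_mul (norm_nonneg c)).mono fun Φ p => ?_
    rw [norm_mul, mul_left_comm]
  | mul_u k _ h =>
    refine (h M N).mono fun Φ p => ?_
    rw [norm_mul, Complex.norm_real]
    refine mul_le_mul_of_nonneg_left (mul_le_of_le_one_left (norm_nonneg _) ?_) (by positivity)
    exact (PiLp.norm_apply_le (p.1 : Rn d) k).trans (norm_eq_of_mem_sphere p.1).le
  | @mul_a k W _ h =>
    refine (h M (N + 1)).mono fun Φ p => ?_
    have h1 : ‖p.2.2 k‖ ≤ 1 + ‖p.2.2‖ ^ 2 := by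
      have := PiLp.norm_apply_le p.2.2 k
      nlinarith [sq_nonneg (‖p.2.2‖ - 1)]
    rw [norm_mul, Complex.norm_real, pow_succ]
    calc (1 + p.2.1 ^ 2) ^ M * (1 + ‖p.2.2‖ ^ 2) ^ N * (‖p.2.2 k‖ * ‖W Φ p‖)
        ≤ (1 + p.2.1 ^ 2) ^ M * (1 + ‖p.2.2‖ ^ 2) ^ N * ((1 + ‖p.2.2‖ ^ 2) * ‖W Φ p‖) := by
          gcongr
      _ = _ := by ring

end CoefficientFamily

/-! ### Integration over `𝕐²ⁿ` -/

instance (d : ℕ) : MeasureTheory.IsFiniteMeasure (sphereMeasure d) := by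
  -- The normalising constant is finite because the surface measure is nonzero.
  refine MeasureTheory.Measure.smul_finite _ (ENNReal.inv_ne_top.2 ?_)
  rw [Ne, MeasureTheory.Measure.measure_univ_eq_zero]
  exact MeasureTheory.Measure.toSphere_ne_zero _

/-- A weight on `𝕐²ⁿ` with integrable inverse. -/
def weightY {d : ℕ} (p : Y d) : ℝ := (1 + p.2.1 ^ 2) * (1 + ‖p.2.2‖ ^ 2) ^ (d + 1)

theorem weightY_pos {d : ℕ} (p : Y d) : 0 < weightY p := by
  unfold weightY
  positivity

theorem integrable_inv_weightY (d : ℕ) :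
    MeasureTheory.Integrable (fun p : Y d => (weightY p)⁻¹) (measureY d) := by
  have h1 : MeasureTheory.Integrable (fun a : Rn d => ((1 + ‖a‖ ^ 2) ^ (d + 1))⁻¹) := by
    -- With n = d + 1, the factor decays like ‖a‖^(-2n), and any exponent above n suffices.
    have h := integrable_rpow_neg_one_add_norm_sq (E := Rn d) (μ := MeasureTheory.volume)
      (r := 2 * ((d + 1 : ℕ) : ℝ)) (by rw [finrank_euclideanSpace_fin]; push_cast; linarith)
    refine h.congr (.of_forall fun a => ?_)
    have : -(2 * ((d + 1 : ℕ) : ℝ)) / 2 = -((d + 1 : ℕ) : ℝ) := by ring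
    simp only [this]
    rw [Real.rpow_neg (by positivity), Real.rpow_natCast]
  have h2 := (MeasureTheory.integrable_const (μ := sphereMeasure d) (1 : ℝ)).mul_prod
    (integrable_inv_one_add_sq.mul_prod h1)
  refine h2.congr (.of_forall fun p => ?_)
  simp [weightY, mul_comm]

theorem IsSmooth.continuous {d : ℕ} {Φ : Y d → ℂ} (h : IsSmooth Φ) : Continuous Φ :=
  ContMDiff.continuous h

/-- By Fubini it suffices to integrate in a for almost every (u, b), where the slice and its
derivative are integrable. -/
theorem integral_partialA_eq_zero {d : ℕ} (k : Fin (d + 1)) {Φ : Y d → ℂ} (h : IsSmooth Φ)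
    (hi : MeasureTheory.Integrable Φ (measureY d))
    (hi' : MeasureTheory.Integrable (partialA k Φ) (measureY d)) :
    ∫ p, partialA k Φ p ∂(measureY d) = 0 := by
  unfold measureY at hi hi' ⊢
  rw [MeasureTheory.integral_prod _ hi']
  refine MeasureTheory.integral_eq_zero_of_ae ?_
  filter_upwards [hi.prod_right_ae, hi'.prod_right_ae] with u hu hu'
  rw [MeasureTheory.integral_prod _ hu']
  refine MeasureTheory.integral_eq_zero_of_ae ?_
  filter_upwards [hu.prod_right_ae, hu'.prod_right_ae] with b hb hb'
  exact integral_fderiv_eq_zero (f := fun a => Φ (u, b, a)) (EuclideanSpace.single k 1)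
    (fun a => (h.slice_a (u, b, a)).differentiableAt (by simp)) hb hb'

/-! ### The synthesis transform -/

/-- The transform `∫ F(u, b, a) χ(⟨u, x⟩ - b) K_α(x, a) db da du`. -/
def synth {d : ℕ} (α : Fin (d + 1) → ℝ) (χ : 𝓢(ℝ, ℂ)) (F : Y d → ℂ) (x : Rn d) : ℂ :=
  ∫ p, F p * ridge α χ x ((p.1 : Rn d), p.2) ∂(measureY d)

theorem continuous_coe_Y {d : ℕ} :
    Continuous fun p : Y d => (((p.1 : Rn d), p.2) : Rn d × ℝ × Rn d) := by
  fun_prop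

namespace CoefficientFamily

variable {d : ℕ} {W : SchwartzY d → Y d → ℂ}

theorem isDominated_weightY (hW : CoefficientFamily W) :
    IsDominated fun Φ p => weightY p * ((1 + p.2.1 ^ 2) * (1 + ‖p.2.2‖ ^ 2) * ‖W Φ p‖) := by
  refine (hW.isDominated 2 (d + 2)).mono fun Φ p => le_of_eq ?_
  rw [weightY]
  ring

/-- Beyond the integrable factor there is a spare (1 + b²)(1 + ‖a‖²), which pays for the linear
growth of the ridge derivative. -/
theorem exists_norm_le (hW : CoefficientFamily W) :
    ∃ q : Seminorm ℂ (SchwartzY d), Continuous q ∧ ∀ Φ p,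
      (1 + p.2.1 ^ 2) * (1 + ‖p.2.2‖ ^ 2) * ‖W Φ p‖ ≤ q Φ * (weightY p)⁻¹ := by
  obtain ⟨q, hq, hb⟩ := hW.isDominated_weightY
  refine ⟨q, hq, fun Φ p => ?_⟩
  rw [← div_eq_mul_inv, le_div_iff₀ (weightY_pos p), mul_comm]
  exact hb Φ p

theorem norm_le_of_weighted_le {c : ℝ} {Φ : SchwartzY d} {p : Y d}
    (h : (1 + p.2.1 ^ 2) * (1 + ‖p.2.2‖ ^ 2) * ‖W Φ p‖ ≤ c) : ‖W Φ p‖ ≤ c := by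
  refine le_trans (le_mul_of_one_le_left (norm_nonneg _) ?_) h
  exact one_le_mul_of_one_le_of_one_le (by nlinarith [sq_nonneg p.2.1])
    (by nlinarith [sq_nonneg ‖p.2.2‖])

theorem integrable (hW : CoefficientFamily W) (Φ : SchwartzY d) :
    MeasureTheory.Integrable (W Φ) (measureY d) := by
  obtain ⟨q, -, hb⟩ := hW.exists_norm_le
  exact ((integrable_inv_weightY d).const_mul (q Φ)).mono'
    (hW.isSmooth Φ).continuous.aestronglyMeasurable
    (.of_forall fun p => norm_le_of_weighted_le (hb Φ p))

theorem hasIntegral_synth (hW : CoefficientFamily W) (α : Fin (d + 1) → ℝ) (χ : 𝓢(ℝ, ℂ))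
    (Φ : SchwartzY d) (x : Rn d) :
    HasIntegral (measureY d) (fun p => W Φ p * ridge α χ x ((p.1 : Rn d), p.2))
      (synth α χ (W Φ) x) :=
  ⟨(hW.integrable Φ).mul_bdd
    ((contDiff_ridge_right α χ x).continuous.comp continuous_coe_Y).aestronglyMeasurable
    (.of_forall fun _ => norm_ridge_le α χ x _), rfl⟩

theorem isDominated_synth (hW : CoefficientFamily W) (α : Fin (d + 1) → ℝ) (χ : 𝓢(ℝ, ℂ)) :
    IsDominated fun Φ x => ‖synth α χ (W Φ) x‖ := by
  obtain ⟨q, hq, hb⟩ := hW.exists_norm_le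
  have h0 : IsDominated fun (Φ : SchwartzY d) (_ : Rn d) => q Φ := ⟨q, hq, fun _ _ => le_rfl⟩
  set C := SchwartzMap.seminorm ℝ 0 0 χ * ‖kernelConst α‖
  have hC : 0 ≤ C := by positivity
  have hI : 0 ≤ ∫ p, (weightY p)⁻¹ ∂(measureY d) :=
    MeasureTheory.integral_nonneg fun p => (inv_pos.2 (weightY_pos p)).le
  refine (h0.const_mul (mul_nonneg hI hC)).mono fun Φ x => ?_
  have h := MeasureTheory.norm_integral_le_of_norm_le
    ((integrable_inv_weightY d).const_mul (q Φ * C))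
    (.of_forall fun p => show ‖W Φ p * ridge α χ x ((p.1 : Rn d), p.2)‖ ≤ _ from ?_)
  · refine h.trans (le_of_eq ?_)
    rw [MeasureTheory.integral_const_mul]
    ring
  · rw [norm_mul]
    calc _ ≤ q Φ * (weightY p)⁻¹ * C := by
          gcongr
          · exact (norm_nonneg _).trans (norm_le_of_weighted_le (hb Φ p))
          · exact norm_le_of_weighted_le (hb Φ p)
          · exact norm_ridge_le α χ x _
      _ = _ := by ring

theorem hasFDerivAt_synth (hW : CoefficientFamily W) (α : Fin (d + 1) → ℝ) (χ : 𝓢(ℝ, ℂ))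
    (Φ : SchwartzY d) (x : Rn d) :
    MeasureTheory.Integrable
      (fun p : Y d => W Φ p • fderiv ℝ (fun x => ridge α χ x ((p.1 : Rn d), p.2)) x)
      (measureY d) ∧
    HasFDerivAt (synth α χ (W Φ))
      (∫ p, W Φ p • fderiv ℝ (fun x => ridge α χ x ((p.1 : Rn d), p.2)) x ∂(measureY d)) x := by
  obtain ⟨C, hC, hb⟩ := exists_norm_ridgeDeriv_le α χ
  obtain ⟨q, -, hq⟩ := hW.exists_norm_le
  have hcont : ∀ x, Continuous fun p : Y d =>
      W Φ p • fderiv ℝ (fun x => ridge α χ x ((p.1 : Rn d), p.2)) x := fun x => by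
    have h : ContDiff ℝ ∞ (fun z : (Rn d × ℝ × Rn d) × Rn d => ridge α χ z.2 z.1) :=
      (contDiff_ridge α χ).comp (f := fun z : (Rn d × ℝ × Rn d) × Rn d => (z.2, z.1))
        (contDiff_snd.prodMk contDiff_fst)
    have h' : Continuous fun q : Rn d × ℝ × Rn d => fderiv ℝ (fun x => ridge α χ x q) x :=
      ContDiff.continuous (𝕜 := ℝ) (n := ∞)
        (ContDiff.fderiv (f := fun q x => ridge α χ x q) (g := fun _ => x) (n := ∞) h
          contDiff_const (by simp))
    exact (hW.isSmooth Φ).continuous.smul (h'.comp continuous_coe_Y)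
  have hbound : ∀ p : Y d, ∀ y ∈ Metric.ball x 1,
      ‖W Φ p • fderiv ℝ (fun x => ridge α χ x ((p.1 : Rn d), p.2)) y‖ ≤
        4 * C * (3 + ‖x‖) * q Φ * (weightY p)⁻¹ := by
    intro p y hy
    have hy' : ‖y‖ ≤ 1 + ‖x‖ := by
      have h := norm_le_norm_add_norm_sub' y x
      rw [mem_ball_iff_norm] at hy
      linarith
    have hp : ‖(((p.1 : Rn d), p.2) : Rn d × ℝ × Rn d)‖ ≤ 1 + |p.2.1| + ‖p.2.2‖ := by
      simp only [Prod.norm_def, norm_eq_of_mem_sphere p.1, Real.norm_eq_abs]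
      have h1 := abs_nonneg p.2.1
      have h2 := norm_nonneg p.2.2
      exact max_le (by linarith) (max_le (by linarith) (by linarith))
    have h1 : ‖fderiv ℝ (fun x => ridge α χ x ((p.1 : Rn d), p.2)) y‖ ≤
        C * (1 + ‖y‖ + ‖(((p.1 : Rn d), p.2) : Rn d × ℝ × Rn d)‖) := by
      refine ContinuousLinearMap.opNorm_le_bound _ (by positivity) fun w => ?_
      rw [fderiv_ridge_left]
      simpa using hb y ((p.1 : Rn d), p.2) w 0
    -- The left side is at most 3 + ‖x‖ + |b| + ‖a‖. Each of 1, |b|, ‖a‖ is at most the product on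
    -- the right, so the constant 4 is ample.
    have h2 : 1 + ‖y‖ + ‖(((p.1 : Rn d), p.2) : Rn d × ℝ × Rn d)‖ ≤
        4 * (3 + ‖x‖) * ((1 + p.2.1 ^ 2) * (1 + ‖p.2.2‖ ^ 2)) := by
      have h3 : |p.2.1| ≤ 1 + p.2.1 ^ 2 := by
        rw [← sq_abs]
        nlinarith [sq_nonneg (|p.2.1| - 1)]
      have h4 : ‖p.2.2‖ ≤ 1 + ‖p.2.2‖ ^ 2 := by nlinarith [sq_nonneg (‖p.2.2‖ - 1)]
      have h5 := mul_nonneg (sq_nonneg p.2.1) (sq_nonneg ‖p.2.2‖)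
      have h6 := norm_nonneg x
      set t := (1 + p.2.1 ^ 2) * (1 + ‖p.2.2‖ ^ 2) with ht
      have h7 : 1 + p.2.1 ^ 2 ≤ t := by nlinarith [sq_nonneg ‖p.2.2‖]
      have h8 : 1 + ‖p.2.2‖ ^ 2 ≤ t := by nlinarith [sq_nonneg p.2.1]
      have h9 : 1 ≤ t := by nlinarith [sq_nonneg p.2.1]
      nlinarith [mul_nonneg h6 (sub_nonneg.2 h9)]
    rw [norm_smul]
    calc _ ≤ ‖W Φ p‖ * (C * (4 * (3 + ‖x‖) * ((1 + p.2.1 ^ 2) * (1 + ‖p.2.2‖ ^ 2)))) := by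
          gcongr
          exact h1.trans (by gcongr)
      _ = 4 * C * (3 + ‖x‖) * ((1 + p.2.1 ^ 2) * (1 + ‖p.2.2‖ ^ 2) * ‖W Φ p‖) := by ring
      _ ≤ 4 * C * (3 + ‖x‖) * (q Φ * (weightY p)⁻¹) :=
          mul_le_mul_of_nonneg_left (hq Φ p) (by positivity)
      _ = _ := by ring
  have hint := (integrable_inv_weightY d).const_mul (4 * C * (3 + ‖x‖) * q Φ)
  refine ⟨hint.mono' (hcont x).aestronglyMeasurable
    (.of_forall fun p => hbound p x (Metric.mem_ball_self one_pos)), ?_⟩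
  exact hasFDerivAt_integral_of_dominated_of_fderiv_le (Metric.ball_mem_nhds x one_pos)
    (.of_forall fun y => (hW.hasIntegral_synth α χ Φ y).integrable.aestronglyMeasurable)
    (hW.hasIntegral_synth α χ Φ x).integrable (hcont x).aestronglyMeasurable
    (.of_forall hbound) hint
    (.of_forall fun p y _ =>
      ((contDiff_ridge_left α χ _).differentiable (by simp) y).hasFDerivAt.const_mul (W Φ p))

theorem fderiv_synth (hW : CoefficientFamily W) (α : Fin (d + 1) → ℝ) (χ : 𝓢(ℝ, ℂ))
    (Φ : SchwartzY d) (x v : Rn d) :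
    fderiv ℝ (synth α χ (W Φ)) x v =
      (∑ k, (v k : ℂ) * synth α (SchwartzMap.derivCLM ℂ ℂ χ)
        (fun p => ((p.1 : Rn d) k : ℂ) * W Φ p) x) +
      ∑ k, Complex.I * v k * (Real.cot (α k) * (x k * synth α χ (W Φ) x) -
        (Real.sin (α k) : ℂ)⁻¹ * synth α χ (fun p => (p.2.2 k : ℂ) * W Φ p) x) := by
  obtain ⟨hi, h⟩ := hW.hasFDerivAt_synth α χ Φ x
  rw [h.fderiv, ContinuousLinearMap.integral_apply hi]
  set χ' := SchwartzMap.derivCLM ℂ ℂ χ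
  have key := (HasIntegral.sum Finset.univ fun k _ =>
    ((hW.mul_u k).hasIntegral_synth α χ' Φ x).const_mul (v k)).add
    (HasIntegral.sum Finset.univ fun k _ =>
      ((((hW.hasIntegral_synth α χ Φ x).const_mul (x k)).const_mul (Real.cot (α k))).sub
        (((hW.mul_a k).hasIntegral_synth α χ Φ x).const_mul (Real.sin (α k) : ℂ)⁻¹)).const_mul
          (Complex.I * v k))
  rw [← key.eq]
  congr 1
  ext p
  simp only [smul_apply, fderiv_ridge_left, ridgeDeriv, smul_eq_mul, phaseGrad_zero,
    Prod.snd_zero, Prod.fst_zero, inner_zero_left, add_zero, zero_add, sub_zero]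
  simp only [phaseGrad]
  push_cast
  rw [ofReal_inner_eq_sum]
  simp only [Finset.mul_sum, Finset.sum_mul, mul_add, mul_sub, sub_mul]
  congr 1
  · exact Finset.sum_congr rfl fun k _ => by ring
  · exact Finset.sum_congr rfl fun k _ => by ring

/-- The dual of `coord_a_mul_analysis`: integrate by parts in a_k and solve for x_k. The window does
not depend on a, so no χ' appears. -/
theorem coord_mul_synth (hW : CoefficientFamily W) (α : Fin (d + 1) → ℝ) (χ : 𝓢(ℝ, ℂ))
    (Φ : SchwartzY d) (x : Rn d) (k : Fin (d + 1)) (hk : Real.sin (α k) ≠ 0) :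
    x k * synth α χ (W Φ) x =
      Real.sin (α k) * (Real.cot (α k) * synth α χ (fun p => (p.2.2 k : ℂ) * W Φ p) x -
        Complex.I * synth α χ (DSTFRFT.partialA k (W Φ)) x) := by
  have hs := isSmooth_restrict (contDiff_ridge_right α χ x)
  have hWs := hW.isSmooth Φ
  have key := ((hW.partialA k).hasIntegral_synth α χ Φ x).add
    ((((hW.mul_a k).hasIntegral_synth α χ Φ x).const_mul (Complex.I * Real.cot (α k))).sub
      ((hW.hasIntegral_synth α χ Φ x).const_mul (Complex.I * (Real.sin (α k) : ℂ)⁻¹ * x k)))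
  have e : DSTFRFT.partialA k (fun p => W Φ p * ridge α χ x ((p.1 : Rn d), p.2)) =
      fun p => DSTFRFT.partialA k (W Φ) p * ridge α χ x ((p.1 : Rn d), p.2) +
        (Complex.I * Real.cot (α k) * (p.2.2 k * W Φ p * ridge α χ x ((p.1 : Rn d), p.2)) -
          Complex.I * (Real.sin (α k) : ℂ)⁻¹ * x k *
            (W Φ p * ridge α χ x ((p.1 : Rn d), p.2))) := by
    rw [partialA_eq_dirDeriv k (hWs.mul hs), dirDeriv_mul hWs hs, partialA_eq_dirDeriv k hWs]
    ext p
    rw [dirDeriv_restrict (contDiff_ridge_right α χ x), fderiv_ridge_right]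
    simp [ridgeDeriv, phaseGrad_zero, phaseGrad_single]
    ring
  rw [← e] at key
  have h0 := key.eq.symm.trans (integral_partialA_eq_zero k (hWs.mul hs)
    (hW.hasIntegral_synth α χ Φ x).integrable key.integrable)
  have hs : (Real.sin (α k) : ℂ) * (Real.sin (α k) : ℂ)⁻¹ = 1 :=
    mul_inv_cancel₀ (by exact_mod_cast hk)
  linear_combination (Complex.I * Real.sin (α k)) * h0 -
    x k * synth α χ (W Φ) x * hs + (x k * synth α χ (W Φ) x * Real.sin (α k) *
      (Real.sin (α k) : ℂ)⁻¹ - Real.sin (α k) * Real.cot (α k) *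
        synth α χ (fun p => (p.2.2 k : ℂ) * W Φ p) x) * Complex.I_sq

end CoefficientFamily

/-! ### Closure and decay of synthesis families. -/

/-- The families of functions on `ℝⁿ` spanned by the synthesis transforms of coefficient
families. -/
inductive SynthesisFamily {d : ℕ} (α : Fin (d + 1) → ℝ) : (SchwartzY d → Rn d → ℂ) → Prop
  | base {W : SchwartzY d → Y d → ℂ} (hW : CoefficientFamily W) (χ : 𝓢(ℝ, ℂ)) :
      SynthesisFamily α fun Φ => synth α χ (W Φ)
  | add {V W : SchwartzY d → Rn d → ℂ} : SynthesisFamily α V → SynthesisFamily α W →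
      SynthesisFamily α fun Φ x => V Φ x + W Φ x
  | const_mul (c : ℂ) {W : SchwartzY d → Rn d → ℂ} : SynthesisFamily α W →
      SynthesisFamily α fun Φ x => c * W Φ x

namespace SynthesisFamily

variable {d : ℕ} {α : Fin (d + 1) → ℝ} {V W : SchwartzY d → Rn d → ℂ}

theorem sub (hV : SynthesisFamily α V) (hW : SynthesisFamily α W) :
    SynthesisFamily α fun Φ x => V Φ x - W Φ x := by
  simpa only [neg_one_mul, ← sub_eq_add_neg] using hV.add (hW.const_mul (-1))

theorem sum {ι : Type*} (s : Finset ι) {W : ι → SchwartzY d → Rn d → ℂ}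
    (h : ∀ i ∈ s, SynthesisFamily α (W i)) : SynthesisFamily α fun Φ x => ∑ i ∈ s, W i Φ x := by
  classical
  induction s using Finset.induction_on with
  | empty => simpa using (base (α := α) (.base 0) 0).const_mul 0
  | insert i s hi ih =>
    simp only [Finset.sum_insert hi]
    exact (h i (Finset.mem_insert_self i s)).add
      (ih fun j hj => h j (Finset.mem_insert_of_mem hj))

theorem isDominated (hW : SynthesisFamily α W) : IsDominated fun Φ x => ‖W Φ x‖ := by
  induction hW with
  | base hW χ => exact hW.isDominated_synth α χ
  | add _ _ h h' => exact (h.add h').mono fun φ p => norm_add_le _ _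
  | const_mul c _ h => exact (h.const_mul (norm_nonneg c)).mono fun φ p => (norm_mul _ _).le

theorem mul_x (hα : ∀ k, Real.sin (α k) ≠ 0) (k : Fin (d + 1)) (hW : SynthesisFamily α W) :
    SynthesisFamily α fun Φ x => (x k : ℂ) * W Φ x := by
  induction hW with
  | base hW χ =>
    simp only [fun Φ x => hW.coord_mul_synth α χ Φ x k (hα k)]
    exact (((base (hW.mul_a k) χ).const_mul _).sub
      ((base (hW.partialA k) χ).const_mul _)).const_mul _
  | add _ _ h h' => simpa only [mul_add] using h.add h'
  | const_mul c _ h => simpa only [mul_left_comm] using h.const_mul c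

theorem differentiable (hW : SynthesisFamily α W) (Φ : SchwartzY d) :
    Differentiable ℝ (W Φ) := by
  induction hW with
  | base hW χ => exact fun x => (hW.hasFDerivAt_synth α χ Φ x).2.differentiableAt
  | add _ _ h h' => exact h.add h'
  | const_mul c _ h => exact h.const_mul c

/-- The factors u_k and a_k produced by differentiation join the coefficient; the factor x_k depends
on the outer variable and is removed by `mul_x`. -/
theorem fderiv_apply (hα : ∀ k, Real.sin (α k) ≠ 0) (v : Rn d) (hW : SynthesisFamily α W) :
    SynthesisFamily α fun Φ x => fderiv ℝ (W Φ) x v := by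
  induction hW with
  | base hW χ =>
    simp only [hW.fderiv_synth]
    exact (sum _ fun k _ => (base (hW.mul_u k) _).const_mul _).add
      (sum _ fun k _ => ((((base hW χ).mul_x hα k).const_mul _).sub
        ((base (hW.mul_a k) χ).const_mul _)).const_mul _)
  | add hV hW h h' =>
    simp only [fun Φ x => fderiv_fun_add (hV.differentiable Φ x) (hW.differentiable Φ x)]
    exact h.add h'
  | const_mul c hW h =>
    simp only [fun Φ x => fderiv_const_mul (hW.differentiable Φ x) c]
    exact h.const_mul c

theorem contDiff (hα : ∀ k, Real.sin (α k) ≠ 0) (hW : SynthesisFamily α W) (Φ : SchwartzY d) :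
    ContDiff ℝ ∞ (W Φ) := by
  rw [contDiff_infty]
  intro n
  induction n generalizing W with
  | zero => exact contDiff_zero.2 (hW.differentiable Φ).continuous
  | succ n ih =>
    exact contDiff_succ_iff_fderiv_apply.2 ⟨hW.differentiable Φ,
      fun h => absurd h (WithTop.natCast_ne_top n), fun v => ih (hW.fderiv_apply hα v)⟩

/-- Each power of ‖x‖ is at most Σ |x_k|, and every x_k is absorbed by the family. -/
theorem isDominated_pow_mul (hα : ∀ k, Real.sin (α k) ≠ 0) (m : ℕ) (hW : SynthesisFamily α W) :
    IsDominated fun Φ x => ‖x‖ ^ m * ‖W Φ x‖ := by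
  induction m generalizing W with
  | zero => simpa using hW.isDominated
  | succ m ih =>
    refine (IsDominated.sum Finset.univ fun k _ => ih (hW.mul_x hα k)).mono fun Φ x => ?_
    have hx : ‖x‖ ≤ ∑ k, |x k| := by
      have h := norm_sum_le Finset.univ fun k => x k • EuclideanSpace.single k (1 : ℝ)
      have e : ∑ k, x k • EuclideanSpace.single k (1 : ℝ) = x := by
        ext j
        simp [Pi.single_apply]
      rw [e] at h
      simpa [norm_smul] using h
    simp only [norm_mul, Complex.norm_real, ← Finset.mul_sum, ← Finset.sum_mul,
      Real.norm_eq_abs]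
    rw [pow_succ, mul_assoc]
    gcongr

/-- The differential is a finite sum of fixed linear images of its coordinate derivatives, which
belong to the class; this lowers the order by one. -/
theorem isDominated_iteratedFDeriv (hα : ∀ k, Real.sin (α k) ≠ 0) (m n : ℕ)
    (hW : SynthesisFamily α W) :
    IsDominated fun Φ x => ‖x‖ ^ m * ‖iteratedFDeriv ℝ n (W Φ) x‖ := by
  induction n generalizing W with
  | zero => simpa only [norm_iteratedFDeriv_zero] using hW.isDominated_pow_mul hα m
  | succ n ih =>
    -- `L k` sends c to the functional v ↦ v_k c.
    set L : Fin (d + 1) → ℂ →L[ℝ] (Rn d →L[ℝ] ℂ) := fun k =>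
      ContinuousLinearMap.smulRightL ℝ (Rn d) ℂ (EuclideanSpace.proj (𝕜 := ℝ) k) with hL
    refine (IsDominated.sum Finset.univ fun k _ =>
      (ih (hW.fderiv_apply hα (EuclideanSpace.single k 1))).const_mul
        (norm_nonneg (L k))).mono fun Φ x => ?_
    have e : fderiv ℝ (W Φ) = fun x => ∑ k, (L k ∘ fun x =>
        fderiv ℝ (W Φ) x (EuclideanSpace.single k 1)) x := by
      ext x v
      have hv : v = ∑ k, v k • EuclideanSpace.single k (1 : ℝ) := by
        ext j
        simp [Pi.single_apply]
      conv_lhs => rw [hv]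
      simp [hL]
    have hc : ∀ k, ContDiff ℝ n fun x => fderiv ℝ (W Φ) x (EuclideanSpace.single k 1) :=
      fun k => ((hW.fderiv_apply hα (EuclideanSpace.single k 1)).contDiff hα Φ).of_le
        (by exact_mod_cast le_top)
    have e' : iteratedFDeriv ℝ n (fderiv ℝ (W Φ)) x = ∑ k, iteratedFDeriv ℝ n (L k ∘ fun x =>
        fderiv ℝ (W Φ) x (EuclideanSpace.single k 1)) x :=
      (congrArg (fun f => iteratedFDeriv ℝ n f x) e).trans
        (iteratedFDeriv_fun_sum_apply fun k _ => ((L k).contDiff.comp (hc k)).contDiffAt)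
    rw [← norm_iteratedFDeriv_fderiv, e']
    calc _ ≤ ‖x‖ ^ m * ∑ k, ‖iteratedFDeriv ℝ n (L k ∘ fun x =>
          fderiv ℝ (W Φ) x (EuclideanSpace.single k 1)) x‖ := by
          gcongr
          exact norm_sum_le _ _
      _ ≤ ‖x‖ ^ m * ∑ k, ‖L k‖ * ‖iteratedFDeriv ℝ n (fun x =>
          fderiv ℝ (W Φ) x (EuclideanSpace.single k 1)) x‖ := by
          gcongr with k _
          exact (L k).norm_iteratedFDeriv_comp_left (hc k).contDiffAt le_rfl
      _ = _ := by
          rw [Finset.mul_sum]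
          exact Finset.sum_congr rfl fun k _ => by ring

end SynthesisFamily

/-! ### The continuous synthesis operator. -/

/-- The synthesis transform as a linear map `𝒮(𝕐²ⁿ) → 𝒮(ℝⁿ)`. -/
def synthLM {d : ℕ} {α : Fin (d + 1) → ℝ} (hα : ∀ k, Real.sin (α k) ≠ 0) (χ : 𝓢(ℝ, ℂ)) :
    SchwartzY d →ₗ[ℂ] 𝓢(Rn d, ℂ) where
  toFun Φ :=
    -- The zero multi-index derivative of Φ is Φ, written in the form of a generator of the
    -- coefficient families.
    { toFun := synth α χ (partialAMulti 0 Φ)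
      smooth' := (SynthesisFamily.base (.base 0) χ).contDiff hα Φ
      decay' := fun m n => by
        obtain ⟨q, -, hq⟩ :=
          (SynthesisFamily.base (α := α) (.base 0) χ).isDominated_iteratedFDeriv hα m n
        exact ⟨q Φ, hq Φ⟩ }
  map_add' Φ Φ' := by
    ext x
    have h := fun Φ => (CoefficientFamily.base 0).hasIntegral_synth α χ Φ x
    refine Eq.trans ?_ ((h Φ).add (h Φ')).eq
    simp only [← add_mul]
    -- The order-zero mixed derivative is the same function, and its additivity on smooth functions
    -- is already known.
    change synth α χ (mixedDeriv 0 0 0 (Φ + Φ' : Y d → ℂ)) x = _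
    rw [(isRegularOp_mixedDeriv 0 0 0).add Φ.isSmooth Φ'.isSmooth]
    rfl
  map_smul' c Φ := by
    ext x
    have h := fun Φ => (CoefficientFamily.base 0).hasIntegral_synth α χ Φ x
    refine Eq.trans ?_ ((h Φ).const_mul c).eq
    simp only [← mul_assoc]
    change synth α χ (mixedDeriv 0 0 0 (c • Φ : Y d → ℂ)) x = _
    rw [(isRegularOp_mixedDeriv 0 0 0).smul c Φ.isSmooth]
    rfl

/-- The synthesis transform as a continuous linear map `𝒮(𝕐²ⁿ) → 𝒮(ℝⁿ)`. -/
def synthCLM {d : ℕ} {α : Fin (d + 1) → ℝ} (hα : ∀ k, Real.sin (α k) ≠ 0) (χ : 𝓢(ℝ, ℂ)) :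
    SchwartzY d →L[ℂ] 𝓢(Rn d, ℂ) where
  toLinearMap := synthLM hα χ
  cont := by
    refine WithSeminorms.continuous_of_continuous_comp (schwartz_withSeminorms ℂ (Rn d) ℂ) _
      fun i => ?_
    obtain ⟨q, hq, hb⟩ :=
      (SynthesisFamily.base (α := α) (.base 0) χ).isDominated_iteratedFDeriv hα i.1 i.2
    exact Seminorm.continuous_of_le hq fun Φ =>
      SchwartzMap.seminorm_le_bound ℂ _ _ _ (apply_nonneg q Φ) (hb Φ)

theorem partialAMulti_zero {d : ℕ} (Φ : Y d → ℂ) : partialAMulti 0 Φ = Φ := by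
  unfold partialAMulti
  induction List.finRange (d + 1) with
  | nil => rfl
  | cons j L ih => simp

theorem synthCLM_apply {d : ℕ} {α : Fin (d + 1) → ℝ} (hα : ∀ k, Real.sin (α k) ≠ 0)
    (χ : 𝓢(ℝ, ℂ)) (Φ : SchwartzY d) (x : Rn d) : synthCLM hα χ Φ x = synth α χ Φ x := by
  conv_rhs => rw [← partialAMulti_zero (Φ : Y d → ℂ)]
  rfl

theorem synthesisIntegrand_eq {d : ℕ} (ψ : 𝓢(ℝ, ℂ)) (α : Fin (d + 1) → ℝ) (Φ : Y d → ℂ)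
    (x : Rn d) (p : Y d) :
    synthesisIntegrand ψ α Φ x p = Φ p * ridge (-α) ψ x ((p.1 : Rn d), p.2) := by
  rw [synthesisIntegrand, ridge, mul_assoc, real_inner_comm]

/-! ### Complex conjugation and the transposed operators -/

theorem continuous_schwartzConj {d : ℕ} :
    Continuous (schwartzConj : 𝓢(Rn d, ℂ) → 𝓢(Rn d, ℂ)) :=
  (SchwartzMap.postcompCLM (Complex.conjCLE : ℂ →L[ℝ] ℂ)).continuous

theorem schwartzConj_apply {d : ℕ} (φ : 𝓢(Rn d, ℂ)) (x : Rn d) :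
    schwartzConj φ x = conj (φ x) := rfl

theorem schwartzConj_add {d : ℕ} (φ φ' : 𝓢(Rn d, ℂ)) :
    schwartzConj (φ + φ') = schwartzConj φ + schwartzConj φ' := by
  ext x
  simp [schwartzConj_apply]

theorem schwartzConj_smul {d : ℕ} (c : ℂ) (φ : 𝓢(Rn d, ℂ)) :
    schwartzConj (c • φ) = conj c • schwartzConj φ := by
  ext x
  simp [schwartzConj_apply]

namespace SchwartzY

variable {d : ℕ}

/-- Complex conjugation on `𝒮(𝕐²ⁿ)` as a conjugate-linear map. -/
def conjLM (d : ℕ) : SchwartzY d →ₛₗ[starRingEnd ℂ] SchwartzY d where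
  toFun := conjugate
  map_add' Φ Ψ := ext fun p => map_add _ (Φ p) (Ψ p)
  map_smul' c Φ := ext fun p => map_mul _ c (Φ p)

theorem continuous_conjugate : Continuous (conjugate : SchwartzY d → SchwartzY d) := by
  refine WithSeminorms.continuous_of_continuous_comp (withSeminorms d) (conjLM d) fun i => ?_
  refine Seminorm.continuous_of_le (continuous_seminorm i.1 i.2.1 i.2.2.1 i.2.2.2.1 i.2.2.2.2)
    fun Φ => seminorm_le _ _ _ _ _ _ fun p => ?_
  exact (weighted_conj _ _ _ _ _ Φ p).le.trans (weighted_le_seminorm _ _ _ _ _ Φ p)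

theorem conjugate_add (Φ Ψ : SchwartzY d) :
    (Φ + Ψ).conjugate = Φ.conjugate + Ψ.conjugate := (conjLM d).map_add Φ Ψ

theorem conjugate_smul (c : ℂ) (Φ : SchwartzY d) :
    (c • Φ).conjugate = conj c • Φ.conjugate := (conjLM d).map_smulₛₗ c Φ

end SchwartzY

/-- The map `Φ ↦ conj (B (conj Φ))`. -/
def conjSynthesis {d : ℕ} (B : SchwartzY d →L[ℂ] 𝓢(Rn d, ℂ)) : SchwartzY d →L[ℂ] 𝓢(Rn d, ℂ) where
  toFun Φ := schwartzConj (B Φ.conjugate)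
  map_add' Φ Ψ := by rw [SchwartzY.conjugate_add, map_add, schwartzConj_add]
  map_smul' c Φ := by
    rw [SchwartzY.conjugate_smul, map_smul, schwartzConj_smul, Complex.conj_conj, RingHom.id_apply]
  cont := continuous_schwartzConj.comp (B.continuous.comp SchwartzY.continuous_conjugate)

/-- The map `φ ↦ conj (A (conj φ))`. -/
def conjAnalysis {d : ℕ} (A : 𝓢(Rn d, ℂ) →L[ℂ] SchwartzY d) : 𝓢(Rn d, ℂ) →L[ℂ] SchwartzY d where
  toFun φ := (A (schwartzConj φ)).conjugate
  map_add' φ φ' := by rw [schwartzConj_add, map_add, SchwartzY.conjugate_add]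
  map_smul' c φ := by
    rw [schwartzConj_smul, map_smul, SchwartzY.conjugate_smul, Complex.conj_conj, RingHom.id_apply]
  cont := SchwartzY.continuous_conjugate.comp (A.continuous.comp continuous_schwartzConj)

end DSTFRFT

end
-- The proposition.
open DSTFRFT in
theorem mainTheorem6 (d : ℕ) (hd : 1 ≤ d) (α : Fin (d + 1) → ℝ)
    (hα : ∀ k, α k ∈ Set.Ioo (-Real.pi) Real.pi \ {0}) (ψ : 𝓢(ℝ, ℂ)) :
    (∀ (φ : 𝓢(Rn d, ℂ)) (p : Y d),
      MeasureTheory.Integrable (dstfrftIntegrand ψ α φ p)) ∧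
    (∀ (Φ : SchwartzY d) (x : Rn d),
      MeasureTheory.Integrable (synthesisIntegrand ψ α Φ x) (measureY d)) ∧
    ∃ (A : 𝓢(Rn d, ℂ) →L[ℂ] SchwartzY d) (B : SchwartzY d →L[ℂ] 𝓢(Rn d, ℂ)),
      (∀ φ p, A φ p = dstfrft ψ α φ p) ∧
      (∀ Φ x, B Φ x = synthesis ψ α Φ x) ∧
      ∃ (DS : TemperedDual d →L[ℂ] TemperedDualY d)
        (DSstar : TemperedDualY d →L[ℂ] TemperedDual d),
        (∀ f Φ, DS f Φ = f (schwartzConj (B Φ.conjugate))) ∧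
        (∀ F φ, DSstar F φ = F (A (schwartzConj φ)).conjugate) := by
  -- On (-π, π) the sine vanishes only at 0; this is the one property of the angles that is used.
  have hs : ∀ k, Real.sin (α k) ≠ 0 := fun k => by
    obtain ⟨⟨h1, h2⟩, h3⟩ := hα k
    exact fun h => h3 ((Real.sin_eq_zero_iff_of_lt_of_lt h1 h2).1 h)
  have hs' : ∀ k, Real.sin ((-α) k) ≠ 0 := fun k => by
    simpa using hs k
  -- The maps on the duals are precompositions with the conjugated operators, so their defining
  -- formulas hold by definition.
  refine ⟨fun φ p => ?_, fun Φ x => ?_, analysisCLM hs (conjWindow ψ), synthCLM hs' ψ,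
    fun φ p => ?_, fun Φ x => ?_, ContinuousLinearMap.precomp ℂ (conjSynthesis (synthCLM hs' ψ)),
    ContinuousLinearMap.precomp ℂ (conjAnalysis (analysisCLM hs (conjWindow ψ))),
    fun _ _ => rfl, fun _ _ => rfl⟩
  · exact (integrable_mul_ridge α (conjWindow ψ) φ ((p.1 : Rn d), p.2)).congr
      (.of_forall fun x => (dstfrftIntegrand_eq ψ α φ p x).symm)
  · have h := ((CoefficientFamily.base 0).hasIntegral_synth (-α) ψ Φ x).integrable
    rw [partialAMulti_zero] at h
    exact h.congr (.of_forall fun p => (synthesisIntegrand_eq ψ α Φ x p).symm)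
  · exact MeasureTheory.integral_congr_ae
      (.of_forall fun x => (dstfrftIntegrand_eq ψ α φ p x).symm)
  · rw [synthCLM_apply]
    exact MeasureTheory.integral_congr_ae
      (.of_forall fun p => (synthesisIntegrand_eq ψ α Φ x p).symm)
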